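/- Let $n\ge 1$ be an integer, $S\subseteq\mathbb{Z}^2$ a finite set and $f:S\to\mathbb{C}$ a function. An *$S$-triangle* with $n$ rows is an array of integers $(a_{i,j})_{1\le i\le j\le n}$, where $(a_{1,1},\dots,a_{1,n})$ is the bottom row and $a_{i+1,j+1}$ is placed above and between $a_{i,j}$ and $a_{i,j+1}$, together with a set of marked *special entries* among the inner entries $a_{i,j}$, $1\le i<j<n$, no two of which are adjacent in a row, such that: 1. if $a_{i,j}$ is special, then for its *parents* $a_{i+1,j},a_{i+1,j+1}$ there is $s=(r,t)\in S$ with $(a_{i+1,j},a_{i+1,j+1})=(a_{i,j}+r,a_{i,j}+t)$; we say that $a_{i,j}$ is associated to $s$; 2. if $i\ge 2$ and $a_{i,j}$ is not a parent of a special entry, then $a_{i-1,j-1}\le a_{i,j}\le a_{i-1,j}$ in case $a_{i-1,j-1}\le a_{i-1,j}$, and $a_{i-1,j-1}>a_{i,j}>a_{i-1,j}$ in case $a_{i-1,j-1}>a_{i-1,j}$; in the latter case the pair $(a_{i-1,j-1},a_{i-1,j})$ is called an *inversion*. The *weight* of an $S$-triangle is $(-1)^{\#\text{inversions}}\prod_{s\in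 S}f(s)^{\#\text{special entries associated to }s}$. For $k=(k_1,\dots,k_n)\in\mathbb{Z}^n$ let $W_{S,f}(k)$ be the sum of the weights of all $S$-triangles with bottom row $k$. For $k\in\mathbb{Z}^n$ and a function $A$ on $\mathbb{Z}^{n-1}$ define the summation operator recursively by $$\sum_{(l_1,\dots,l_{n-1})}^{(k_1,\dots,k_n)}A(l_1,\dots,l_{n-1})=\sum_{l_{n-1}=k_{n-1}}^{k_n}\ \sum_{(l_1,\dots,l_{n-2})}^{(k_1,\dots,k_{n-1})}A(l_1,\dots,l_{n-1})+\sum_{(l_1,\dots,l_{n-3})}^{(k_1,\dots,k_{n-2})}\ \sum_{(i,j)\in S}f(i,j)\,A(l_1,\dots,l_{n-3},k_{n-1}+i,k_{n-1}+j)$$ for $n\ge2$, where the operator is $A\mapsto A$ if the upper row has length $1$ and zero if it has length $0$, and $\sum_{x=a}^{b}g(x):=-\sum_{x=b+1}^{a-1}g(x)$ if $a>b$. Let $\alpha_{1,1}(1,0,S,f;k_1)=1$ and $\alpha_{1,1}(n,0,S,f;k_1,\dots,k_n)=\sum_{(l_1,\dots,l_{n-1})}^{(k_1,\dots,k_n)}\alpha_{1,1}(n-1,0,S,f;l_1,\dots,l_{n-1})$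 for $n\geq 2$. Finally, let $E_{k_t}$ be the shift operator $k_t\mapsto k_t+1$ on functions of $(k_1,\dots,k_n)\in\mathbb{Z}^n$. **Claim.** Every Laurent polynomial $s(X,Y)\in\mathbb{C}[X^{\pm1},Y^{\pm1}]$ can be written as $s(X,Y)=-\sum_{(i,j)\in S}f(i,j)\,Y^iX^j$ for some finite $S\subseteq\mathbb{Z}^2$ and $f:S\to\mathbb{C}$. For every such representation and every $k\in\mathbb{Z}^n$ (not necessarily increasing), there are only finitely many $S$-triangles with bottom row $k$, and with $r(X,Y)=Y+(X-1)(Y-1)s(X,Y)$ one has $$\prod_{1\le s<t\le n}r(E_{k_s},E_{k_t})\prod_{1\le i<j\le n}\frac{k_j-k_i}{j-i}=\alpha_{1,1}(n,0,S,f;k_1,\dots,k_n)=W_{S,f}(k).$$ In particular, for every $k\in\mathbb{Z}^n$, $$\prod_{1\le s<t\le n}\left(\operatorname{id}-E_{k_s}+E_{k_s}E_{k_t}\right)\prod_{1\le i<j\le n}\frac{k_j-k_i}{j-i}=W_{\{(0,0)\},-1}(k),$$ where $-1$ denotes the constant function with value $-1$. -/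

import Mathlib

noncomputable section

namespace OperatorFormula

/-! ### Laurent polynomials in two variables and shift operators -/

/-- Laurent polynomials over `ℂ` in `X, Y`: the exponent `(a, b)` stands for `X ^ a * Y ^ b`. -/
abbrev Laurent₂ : Type := AddMonoidAlgebra ℂ (ℤ × ℤ)

/-- The variable `X`. -/
def X : Laurent₂ := AddMonoidAlgebra.single (1, 0) 1

/-- The variable `Y`. -/
def Y : Laurent₂ := AddMonoidAlgebra.single (0, 1) 1

/-- `s(X, Y) = - ∑_{(i, j) ∈ S} f(i, j) Y ^ i X ^ j`. -/
def laurentOf (S : Finset (ℤ × ℤ)) (f : S → ℂ) : Laurent₂ :=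
  - ∑ p : S, AddMonoidAlgebra.single ((p : ℤ × ℤ).2, (p : ℤ × ℤ).1) (f p)

/-- The `i`-th power (`i ∈ ℤ`) of the shift operator `E_{k_t}`, which replaces `k_t` by `k_t + 1`,
acting on complex valued functions of `(k_1, …, k_n) ∈ ℤⁿ`. -/
def shiftPow {n : ℕ} (t : Fin n) (i : ℤ) : Module.End ℂ ((Fin n → ℤ) → ℂ) where
  toFun F := fun k => F (k + Pi.single t i)
  map_add' _ _ := rfl
  map_smul' _ _ := rfl

/-- The operator `r(E_{k_s}, E_{k_t})`. -/
def evalShift {n : ℕ} (r : Laurent₂) (s t : Fin n) : Module.End ℂ ((Fin n → ℤ) → ℂ) :=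
  r.coeff.sum fun p c => c • (shiftPow s p.1 * shiftPow t p.2)

theorem shiftPow_commute {n : ℕ} (s t : Fin n) (i j : ℤ) :
    Commute (shiftPow s i) (shiftPow t j) := by
  ext F k
  simp [shiftPow, add_right_comm]

theorem evalShift_commute {n : ℕ} (r : Laurent₂) (s t s' t' : Fin n) :
    Commute (evalShift r s t) (evalShift r s' t') := by
  unfold evalShift Finsupp.sum
  refine Commute.sum_left _ _ _ fun p _ => Commute.sum_right _ _ _ fun q _ => ?_
  refine Commute.smul_left (Commute.smul_right ?_ _) _
  exact ((shiftPow_commute _ _ _ _).mul_right (shiftPow_commute _ _ _ _)).mul_left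
    ((shiftPow_commute _ _ _ _).mul_right (shiftPow_commute _ _ _ _))

/-- The composition `∏_{s < t} r(E_{k_s}, E_{k_t})` of pairwise commuting operators. -/
def prodOperator (n : ℕ) (r : Laurent₂) : Module.End ℂ ((Fin n → ℤ) → ℂ) :=
  (Finset.univ.filter fun p : Fin n × Fin n => p.1 < p.2).noncommProd
    (fun p => evalShift r p.1 p.2) fun _ _ _ _ _ => evalShift_commute r _ _ _ _

/-- The function `∏_{i < j} (k_j - k_i) / (j - i)`. -/
def gtProduct (n : ℕ) (k : Fin n → ℤ) : ℂ :=
  ∏ p ∈ Finset.univ.filter (fun p : Fin n × Fin n => p.1 < p.2),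
    ((k p.2 : ℂ) - (k p.1 : ℂ)) / (((p.2 : ℕ) : ℂ) - ((p.1 : ℕ) : ℂ))

/-! ### The recursion defining `α_{1,1}(n, 0, S, f; k_1, …, k_n)` -/

/-- The sum `∑_{x=a}^{b} g(x)` over integers, which for `a > b` means `- ∑_{x=b+1}^{a-1} g(x)`. -/
def extSum (a b : ℤ) (g : ℤ → ℂ) : ℂ :=
  if a ≤ b then ∑ x ∈ Finset.Icc a b, g x else - ∑ x ∈ Finset.Icc (b + 1) (a - 1), g x

/-- The summation operator `∑_{(l_1, …, l_m)}^{(k_1, …, k_{m+1})} A(l_1, …, l_m)` associated to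
`(S, f)`. For a bottom row of length two the second summand of the recursion is absent,
since the summation operator over an empty upper row is zero. -/
def sumOp (S : Finset (ℤ × ℤ)) (f : S → ℂ) :
    (m : ℕ) → (Fin (m + 1) → ℤ) → ((Fin m → ℤ) → ℂ) → ℂ
  | 0, _, A => A Fin.elim0
  | 1, k, A => extSum (k 0) (k 1) fun l =>
      sumOp S f 0 (Fin.init k) fun l' => A (Fin.snoc (α := fun _ => ℤ) l' l)
  | m + 2, k, A =>
      let y : ℤ := Fin.init k (Fin.last (m + 1))
      let z : ℤ := k (Fin.last (m + 2))
      (extSum y z fun l =>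
        sumOp S f (m + 1) (Fin.init k) fun l' => A (Fin.snoc (α := fun _ => ℤ) l' l))
      + sumOp S f m (Fin.init (Fin.init k)) fun l' => ∑ p : S, f p *
          A (Fin.snoc (α := fun _ => ℤ)
            (Fin.snoc (α := fun _ => ℤ) l' (y + (p : ℤ × ℤ).1)) (y + (p : ℤ × ℤ).2))

/-- `α_{1,1}(n, 0, S, f; k_1, …, k_n)`; the value `1` for `n = 0` only serves to give the
initial value `1` for `n = 1`. -/
def alpha (S : Finset (ℤ × ℤ)) (f : S → ℂ) : (n : ℕ) → (Fin n → ℤ) → ℂ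
  | 0, _ => 1
  | m + 1, k => sumOp S f m k (alpha S f m)

/-! ### `S`-triangles -/

/-- The position `(i, j)` is a parent of one of the marked positions: the parents of `(i, j)` are
`(i + 1, j)` and `(i + 1, j + 1)`. -/
def IsParent (special : Finset (ℕ × ℕ)) (i j : ℕ) : Prop :=
  ∃ p ∈ special, (i, j) = (p.1 + 1, p.2) ∨ (i, j) = (p.1 + 1, p.2 + 1)

instance (special : Finset (ℕ × ℕ)) (i j : ℕ) : Decidable (IsParent special i j) := by
  unfold IsParent; infer_instance

/-- An `S`-triangle with `n` rows: integers `a_{i,j}`, `1 ≤ i ≤ j ≤ n`, together with a set of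
positions of special entries. The row `i = 1` is the bottom row, and `a_{i+1,j+1}` is placed above
and between `a_{i,j}` and `a_{i,j+1}`. Values of `entry` outside of the triangle are fixed to be
`0`, so that they carry no information. -/
@[ext]
structure STriangle (S : Finset (ℤ × ℤ)) (n : ℕ) where
  entry : ℕ → ℕ → ℤ
  entry_outside : ∀ i j, ¬ (1 ≤ i ∧ i ≤ j ∧ j ≤ n) → entry i j = 0
  special : Finset (ℕ × ℕ)
  special_inner : ∀ i j, (i, j) ∈ special → 1 ≤ i ∧ i < j ∧ j < n
  special_not_adjacent : ∀ i j, (i, j) ∈ special → (i, j + 1) ∉ special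
  special_parents : ∀ i j, (i, j) ∈ special →
    ∃ s ∈ S, (entry (i + 1) j, entry (i + 1) (j + 1)) = (entry i j + s.1, entry i j + s.2)
  between_of_le : ∀ i j, 1 ≤ i → i ≤ j → j < n → ¬ IsParent special (i + 1) (j + 1) →
    entry i j ≤ entry i (j + 1) →
      entry i j ≤ entry (i + 1) (j + 1) ∧ entry (i + 1) (j + 1) ≤ entry i (j + 1)
  between_of_gt : ∀ i j, 1 ≤ i → i ≤ j → j < n → ¬ IsParent special (i + 1) (j + 1) →
    entry i j > entry i (j + 1) →
      entry i j > entry (i + 1) (j + 1) ∧ entry (i + 1) (j + 1) > entry i (j + 1)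

namespace STriangle

variable {S : Finset (ℤ × ℤ)} {n : ℕ}

/-- The bottom row of the triangle is `(k_1, …, k_n)`. -/
def HasBottomRow (T : STriangle S n) (k : Fin n → ℤ) : Prop :=
  ∀ j : Fin n, T.entry 1 (j + 1) = k j

/-- The inversions, i.e. the pairs `(a_{i,j}, a_{i,j+1})` with `a_{i,j} > a_{i,j+1}` for which the
entry `a_{i+1,j+1}` above is not a parent of a special entry, recorded by the position `(i, j)`. -/
def inversions (T : STriangle S n) : Finset (ℕ × ℕ) :=
  (Finset.Icc 1 n ×ˢ Finset.Icc 1 n).filter fun p =>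
    p.1 ≤ p.2 ∧ p.2 < n ∧ ¬ IsParent T.special (p.1 + 1) (p.2 + 1) ∧
      T.entry p.1 p.2 > T.entry p.1 (p.2 + 1)

/-- The special entries associated to `s`. -/
def specialAssoc (T : STriangle S n) (s : ℤ × ℤ) : Finset (ℕ × ℕ) :=
  T.special.filter fun p =>
    (T.entry (p.1 + 1) p.2, T.entry (p.1 + 1) (p.2 + 1)) =
      (T.entry p.1 p.2 + s.1, T.entry p.1 p.2 + s.2)

/-- The weight `(-1)^{# inversions} ∏_{s ∈ S} f(s)^{# special entries associated to s}`. -/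
def weight (f : S → ℂ) (T : STriangle S n) : ℂ :=
  (-1) ^ T.inversions.card * ∏ s : S, f s ^ (T.specialAssoc s).card

end STriangle

/-- The sum of the weights of all `S`-triangles with bottom row `(k_1, …, k_n)`. -/
def weightedCount (S : Finset (ℤ × ℤ)) (f : S → ℂ) (n : ℕ) (k : Fin n → ℤ) : ℂ :=
  ∑ᶠ T ∈ {T : STriangle S n | T.HasBottomRow k}, T.weight f

end OperatorFormula

end

noncomputable section

namespace OperatorFormula

open Finset

/-! ### The group algebra of shifts -/

/-! Both equalities are proved by induction on `n`, with `alpha` as the middle term.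

Operator side: write `P_n` for the product of all `r(E_s, E_t)`, `s < t`. The product of differences
is the determinant `D_0 = binDet n 0` of binomials `binom(k_i, j)`, and by Pascal's rule `D_0 = ∏
(E_i - 1) D_1` with `D_1 = binDet n 1`. Hence, by induction, `alpha` in `n` variables is `∏ (E_i -
1) B` with `B = P_n D_1`. Multiplying `P_n` by `r(E_{i+1}, E_i)` makes it symmetric in `k_i,
k_{i+1}`, whereas `D_1` is antisymmetric, so `r(E_{i+1}, E_i) B` vanishes for `k_i = k_{i+1}`
(`pairProd_binDet_mem_vanishing`). This vanishing is what makes the summation operator telescope: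
the special terms cancel the unwanted boundary terms, and an alternating sum of values of `B` with
one argument deleted and the later ones raised by one remains (`sumOp_diffAll`). The determinant in
`n + 1` variables, expanded along its column of ones, gives the same alternating sum after applying
`P_{n+1}`: on functions independent of `k_p`, `E_p` acts as the identity, and `r(1, Y) = Y`, `r(X,
1) = 1` turn `P_{n+1}` into `P_n` times the shifts of the later arguments
(`shiftAct_pairProd_delete`).

Combinatorial side: the recursion for the summation operator distinguishes whether the last inner
entry of a row is special, so the operator is a weighted sum over the rows that may lie above the
given one (`exists_sum_rowChoice`). Removing the bottom row of a triangle is a bijection that splits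
the weight into two factors (`STriangle.bijective_glue`, `STriangle.weight_glue`). -/

/-- The group algebra of `ℤⁿ`, acting on functions on `ℤⁿ` by shifts. -/
abbrev ShiftAlg (n : ℕ) : Type := AddMonoidAlgebra ℂ (Fin n → ℤ)

/-- The monoid homomorphism sending a vector to the shift by it. -/
def shiftHom (n : ℕ) : Multiplicative (Fin n → ℤ) →* Module.End ℂ ((Fin n → ℤ) → ℂ) where
  toFun v :=
    { toFun := fun F k => F (k + v.toAdd)
      map_add' := fun _ _ => rfl
      map_smul' := fun _ _ => rfl }
  map_one' := by ext; simp
  map_mul' u v := by ext F k; simp [add_assoc]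

/-- The action of the group algebra of `ℤⁿ` on functions on `ℤⁿ`. -/
def shiftAct (n : ℕ) : ShiftAlg n →ₐ[ℂ] Module.End ℂ ((Fin n → ℤ) → ℂ) :=
  AddMonoidAlgebra.lift ℂ _ _ (shiftHom n)

theorem shiftAct_single {n : ℕ} (v : Fin n → ℤ) (c : ℂ) (F : (Fin n → ℤ) → ℂ) (k : Fin n → ℤ) :
    shiftAct n (AddMonoidAlgebra.single v c) F k = c * F (k + v) := by
  simp [shiftAct, shiftHom]

/-- Shifting is compatible with affine maps between the lattices. -/
theorem shiftAct_mapDomain {m n : ℕ} (φ : (Fin m → ℤ) →+ (Fin n → ℤ))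
    (h : (Fin m → ℤ) → (Fin n → ℤ)) (hh : ∀ l v, h (l + v) = h l + φ v)
    (x : ShiftAlg m) (G : (Fin n → ℤ) → ℂ) (l : Fin m → ℤ) :
    shiftAct m x (fun l' => G (h l')) l =
      shiftAct n (AddMonoidAlgebra.mapDomainAlgHom ℂ ℂ φ x) G (h l) := by
  induction x using AddMonoidAlgebra.induction_linear with
  | zero => simp
  | add a b ha hb => simp only [map_add, LinearMap.add_apply, Pi.add_apply, ha, hb]
  | single v c =>
    rw [shiftAct_single]
    simp only [AddMonoidAlgebra.mapDomainAlgHom_apply, AddMonoidAlgebra.mapDomain_single]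
    rw [shiftAct_single, hh]

/-- The exponent map `X ↦ E_s`, `Y ↦ E_t`. -/
def expMap {n : ℕ} (s t : Fin n) : ℤ × ℤ →+ (Fin n → ℤ) where
  toFun p := Pi.single s p.1 + Pi.single t p.2
  map_zero' := by simp
  map_add' p q := by simp only [Prod.fst_add, Prod.snd_add, Pi.single_add]; abel

/-- The substitution `X ↦ E_s`, `Y ↦ E_t`. -/
def substShift {n : ℕ} (s t : Fin n) : Laurent₂ →ₐ[ℂ] ShiftAlg n :=
  AddMonoidAlgebra.mapDomainAlgHom ℂ ℂ (expMap s t)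

theorem substShift_single {n : ℕ} (s t : Fin n) (p : ℤ × ℤ) (c : ℂ) :
    substShift s t (AddMonoidAlgebra.single p c) =
      AddMonoidAlgebra.single (Pi.single s p.1 + Pi.single t p.2) c := by
  simp [substShift, expMap]

theorem mapDomainAlgHom_substShift {m n : ℕ} (φ : (Fin m → ℤ) →+ (Fin n → ℤ)) (s t : Fin m)
    (s' t' : Fin n) (hs : ∀ c, φ (Pi.single s c) = Pi.single s' c)
    (ht : ∀ c, φ (Pi.single t c) = Pi.single t' c) (r : Laurent₂) :
    AddMonoidAlgebra.mapDomainAlgHom ℂ ℂ φ (substShift s t r) = substShift s' t' r := by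
  induction r using AddMonoidAlgebra.induction_linear with
  | zero => simp
  | add a b ha hb => simp only [map_add, ha, hb]
  | single p c =>
    rw [substShift_single, substShift_single]
    simp [hs, ht]

theorem evalShift_eq {n : ℕ} (r : Laurent₂) (s t : Fin n) :
    evalShift r s t = shiftAct n (substShift s t r) := by
  induction r using AddMonoidAlgebra.induction_linear with
  | zero => simp [evalShift]
  | add a b ha hb =>
    rw [map_add, map_add, ← ha, ← hb]
    unfold evalShift
    rw [AddMonoidAlgebra.coeff_add, Finsupp.sum_add_index']
    · simp
    · intro p c d; rw [add_smul]
  | single p c =>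
    rw [substShift_single]
    ext F k
    rw [shiftAct_single]
    simp only [evalShift, AddMonoidAlgebra.coeff_single]
    rw [Finsupp.sum_single_index (by simp)]
    simp [shiftPow, add_assoc]

/-- The element `∏_{s < t} r(E_s, E_t)` of the group algebra. -/
def pairProd (n : ℕ) (r : Laurent₂) : ShiftAlg n :=
  ∏ s : Fin n, ∏ t : Fin n, if s < t then substShift s t r else 1

theorem pairProd_eq (n : ℕ) (r : Laurent₂) :
    pairProd n r = ∏ p ∈ univ.filter (fun p : Fin n × Fin n => p.1 < p.2),
      substShift p.1 p.2 r := by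
  rw [Finset.prod_filter, Fintype.prod_prod_type]
  rfl

/-- Moves the product into a commutative ring, where factors can be rearranged and sent through ring
homomorphisms. -/
theorem prodOperator_eq (n : ℕ) (r : Laurent₂) :
    prodOperator n r = shiftAct n (pairProd n r) := by
  have h := Finset.map_noncommProd (univ.filter fun p : Fin n × Fin n => p.1 < p.2)
    (fun p => substShift p.1 p.2 r) (fun _ _ _ _ _ => Commute.all _ _) (shiftAct n)
  rw [Finset.noncommProd_eq_prod, ← pairProd_eq] at h
  rw [h]
  exact Finset.noncommProd_congr rfl (fun p _ => evalShift_eq _ _ _) _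

/-- `E_i`. -/
def shiftVar {n : ℕ} (i : Fin n) : ShiftAlg n := AddMonoidAlgebra.single (Pi.single i 1) 1

theorem shiftAct_shiftVar {n : ℕ} (i : Fin n) (F : (Fin n → ℤ) → ℂ) (k : Fin n → ℤ) :
    shiftAct n (shiftVar i) F k = F (k + Pi.single i 1) := by
  rw [shiftVar, shiftAct_single, one_mul]

theorem mapDomainAlgHom_shiftVar {m n : ℕ} (φ : (Fin m → ℤ) →+ (Fin n → ℤ)) (i : Fin m)
    (i' : Fin n) (h : φ (Pi.single i 1) = Pi.single i' 1) :
    AddMonoidAlgebra.mapDomainAlgHom ℂ ℂ φ (shiftVar i) = shiftVar i' := by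
  simp [shiftVar, h]

theorem substShift_X {n : ℕ} (s t : Fin n) : substShift s t X = shiftVar s := by
  simp [X, substShift_single, shiftVar]

theorem substShift_Y {n : ℕ} (s t : Fin n) : substShift s t Y = shiftVar t := by
  simp [Y, substShift_single, shiftVar]

/-- The Laurent polynomial `r(X, Y) = Y + (X - 1) (Y - 1) s(X, Y)`. -/
abbrev kernelOf (s : Laurent₂) : Laurent₂ := Y + (X - 1) * (Y - 1) * s

/-! ### The summation operator -/

theorem extSum_sub (a b : ℤ) (g h : ℤ → ℂ) :
    extSum a b (fun x => g x - h x) = extSum a b g - extSum a b h := by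
  unfold extSum
  split_ifs <;> rw [Finset.sum_sub_distrib]; ring

/-- The sign convention for `a > b` is the one that makes telescoping valid without any order
assumption; this is why arbitrary bottom rows are allowed. -/
theorem extSum_telescope (a b : ℤ) (g : ℤ → ℂ) :
    extSum a b (fun x => g (x + 1) - g x) = g (b + 1) - g a := by
  have key : ∀ (n : ℕ) (a : ℤ), ∑ x ∈ Finset.Icc a (a + n - 1), (g (x + 1) - g x) =
      g (a + n) - g a := by
    intro n
    induction n with
    | zero => intro a; simp
    | succ n ih =>
      intro a
      have : Finset.Icc a (a + (n + 1 : ℕ) - 1) = insert (a + n) (Finset.Icc a (a + n - 1)) := by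
        ext x; simp only [Finset.mem_Icc, Finset.mem_insert]; push_cast; omega
      rw [this, Finset.sum_insert (by simp), ih]
      push_cast; ring_nf
  unfold extSum
  split_ifs with h
  · obtain ⟨n, hn⟩ := Int.eq_ofNat_of_zero_le (show 0 ≤ b + 1 - a by omega)
    have := key n a
    rw [show a + (n : ℤ) - 1 = b by omega, show a + (n : ℤ) = b + 1 by omega] at this
    exact this
  · obtain ⟨n, hn⟩ := Int.eq_ofNat_of_zero_le (show 0 ≤ a - (b + 1) by omega)
    have := key n (b + 1)
    rw [show b + 1 + (n : ℤ) - 1 = a - 1 by omega, show b + 1 + (n : ℤ) = a by omega] at this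
    rw [this]; ring

theorem sumOp_sub (S : Finset (ℤ × ℤ)) (f : S → ℂ) : ∀ (m : ℕ) (k : Fin (m + 1) → ℤ)
    (A B : (Fin m → ℤ) → ℂ),
    sumOp S f m k (fun l => A l - B l) = sumOp S f m k A - sumOp S f m k B
  | 0, k, A, B => rfl
  | 1, k, A, B => by
    simp only [sumOp]
    rw [extSum_sub]
  | m + 2, k, A, B => by
    simp only [sumOp]
    simp only [sumOp_sub S f (m + 1), extSum_sub, mul_sub, Finset.sum_sub_distrib,
      sumOp_sub S f m]
    ring

/-- `∏ (E_i - 1)`. -/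
def diffAll (m : ℕ) : ShiftAlg m := ∏ i : Fin m, (shiftVar i - 1)

/-- The inclusion `ℤᵐ → ℤᵐ⁺¹` appending a zero. -/
def snocZero (m : ℕ) : (Fin m → ℤ) →+ (Fin (m + 1) → ℤ) where
  toFun v := Fin.snoc (α := fun _ => ℤ) v 0
  map_zero' := by
    ext i; refine Fin.lastCases ?_ (fun j => ?_) i <;> simp
  map_add' u v := by
    ext i; refine Fin.lastCases ?_ (fun j => ?_) i <;> simp

theorem snocZero_single {m : ℕ} (i : Fin m) (c : ℤ) :
    snocZero m (Pi.single i c) = Pi.single i.castSucc c := by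
  ext j
  refine Fin.lastCases ?_ (fun j => ?_) j
  · simp [snocZero, Fin.castSucc_ne_last]
  · simp [snocZero, Pi.single_apply]

theorem snoc_add {m : ℕ} (x : ℤ) (l v : Fin m → ℤ) :
    Fin.snoc (α := fun _ => ℤ) (l + v) x = Fin.snoc (α := fun _ => ℤ) l x + snocZero m v := by
  ext j
  refine Fin.lastCases ?_ (fun j => ?_) j <;> simp [snocZero]

theorem snoc_add_single_last {m : ℕ} (l : Fin m → ℤ) (x c : ℤ) :
    Fin.snoc (α := fun _ => ℤ) l x + Pi.single (Fin.last m) c =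
      Fin.snoc (α := fun _ => ℤ) l (x + c) := by
  ext j
  refine Fin.lastCases ?_ (fun j => ?_) j <;> simp [Fin.castSucc_ne_last]

theorem snoc_add_single_castSucc {m : ℕ} (l : Fin m → ℤ) (x c : ℤ) (i : Fin m) :
    Fin.snoc (α := fun _ => ℤ) l x + Pi.single i.castSucc c =
      Fin.snoc (α := fun _ => ℤ) (l + Pi.single i c) x := by
  rw [snoc_add, snocZero_single]

/-- Splits off the difference in the last argument, which the outermost sum of the summation
operator then telescopes. -/
theorem diffAll_snoc {m : ℕ} (B : (Fin (m + 1) → ℤ) → ℂ) (l : Fin m → ℤ) (x : ℤ) :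
    shiftAct (m + 1) (diffAll (m + 1)) B (Fin.snoc (α := fun _ => ℤ) l x) =
      shiftAct m (diffAll m) (fun l' => B (Fin.snoc (α := fun _ => ℤ) l' (x + 1))) l -
      shiftAct m (diffAll m) (fun l' => B (Fin.snoc (α := fun _ => ℤ) l' x)) l := by
  have h1 : diffAll (m + 1) = AddMonoidAlgebra.mapDomainAlgHom ℂ ℂ (snocZero m) (diffAll m) *
      (shiftVar (Fin.last m) - 1) := by
    unfold diffAll
    rw [Fin.prod_univ_castSucc, map_prod]
    congr 1
    refine Finset.prod_congr rfl fun i _ => ?_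
    rw [map_sub, map_one, mapDomainAlgHom_shiftVar _ _ i.castSucc (snocZero_single i 1)]
  rw [h1, map_mul, Module.End.mul_apply,
    ← shiftAct_mapDomain (snocZero m) (fun l' => Fin.snoc (α := fun _ => ℤ) l' x) (snoc_add x),
    ← Pi.sub_apply, ← map_sub]
  refine congrFun (congrArg _ (funext fun l' => ?_)) l
  simp [shiftAct_shiftVar, snoc_add_single_last]

/-! ### Summing differences of functions that satisfy the vanishing condition -/

/-- The functions `B` such that `r(E_{i+1}, E_i) B` vanishes where the arguments
`i` and `i + 1` agree. -/
def vanishing (r : Laurent₂) (m : ℕ) : Submodule ℂ ((Fin m → ℤ) → ℂ) where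
  carrier := {B | ∀ i j : Fin m, (i : ℕ) + 1 = j → ∀ l, l i = l j →
    shiftAct m (substShift j i r) B l = 0}
  zero_mem' := by intro i j _ l _; simp
  add_mem' ha hb := by
    intro i j h l hl
    simp [ha i j h l hl, hb i j h l hl]
  smul_mem' c a ha := by
    intro i j h l hl
    simp [ha i j h l hl]

theorem vanishing_snoc {r : Laurent₂} {m : ℕ} {B : (Fin (m + 1) → ℤ) → ℂ}
    (hB : B ∈ vanishing r (m + 1)) (x : ℤ) :
    (fun l => B (Fin.snoc (α := fun _ => ℤ) l x)) ∈ vanishing r m := by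
  intro i j h l hl
  rw [shiftAct_mapDomain (snocZero m) (fun l' => Fin.snoc (α := fun _ => ℤ) l' x) (snoc_add x),
    mapDomainAlgHom_substShift _ _ _ j.castSucc i.castSucc (snocZero_single j)
      (snocZero_single i)]
  exact hB _ _ (by simpa using h) _ (by simpa using hl)

/-- Deletion of the argument `p`, with later arguments increased by one. -/
def deleteShift {m : ℕ} (p : Fin (m + 1)) (k : Fin (m + 1) → ℤ) : Fin m → ℤ :=
  fun i => k (p.succAbove i) + if i.castSucc < p then 0 else 1

/-- The increment of the surviving last argument matches the upper boundary value at `z + 1` in a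
telescoping sum up to `z`. -/
theorem deleteShift_castSucc {m : ℕ} (p : Fin (m + 1)) (k : Fin (m + 2) → ℤ) :
    deleteShift p.castSucc k =
      Fin.snoc (α := fun _ => ℤ) (deleteShift p (Fin.init k)) (k (Fin.last (m + 1)) + 1) := by
  ext i
  refine Fin.lastCases ?_ (fun i => ?_) i
  · have : ¬ (Fin.last m).castSucc < p.castSucc := by
      simp [Fin.lt_def]; omega
    simp only [deleteShift, this, Fin.snoc_last, if_false]
    rw [Fin.succAbove_of_le_castSucc _ _ (not_lt.mp this), Fin.succ_last]
  · simp only [deleteShift, Fin.snoc_castSucc, Fin.init, Fin.castSucc_lt_castSucc_iff,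
      Fin.castSucc_succAbove_castSucc]

theorem deleteShift_last {m : ℕ} (k : Fin (m + 1) → ℤ) :
    deleteShift (Fin.last m) k = Fin.init k := by
  ext i
  simp [deleteShift, Fin.init, Fin.castSucc_lt_last]

theorem shiftAct_substShift_kernelOf {n : ℕ} (S : Finset (ℤ × ℤ)) (f : S → ℂ) (s t : Fin n)
    (B : (Fin n → ℤ) → ℂ) (k : Fin n → ℤ) :
    shiftAct n (substShift s t (kernelOf (laurentOf S f))) B k =
      B (k + Pi.single t 1) - ∑ p : S, f p *
        shiftAct n ((shiftVar s - 1) * (shiftVar t - 1)) B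
          (k + (Pi.single s (p : ℤ × ℤ).2 + Pi.single t (p : ℤ × ℤ).1)) := by
  have h : substShift s t (kernelOf (laurentOf S f)) = shiftVar t - ∑ p : S,
      AddMonoidAlgebra.single (Pi.single s (p : ℤ × ℤ).2 + Pi.single t (p : ℤ × ℤ).1) (f p) *
        ((shiftVar s - 1) * (shiftVar t - 1)) := by
    simp only [kernelOf, laurentOf, map_add, map_mul, map_sub, map_one, map_neg, map_sum,
      substShift_X, substShift_Y, substShift_single]
    rw [← Finset.sum_mul]
    ring
  rw [h]
  simp only [map_sub, map_sum, LinearMap.sub_apply, Pi.sub_apply, shiftAct_shiftVar,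
    LinearMap.sum_apply, Finset.sum_apply]
  congr 1
  refine Finset.sum_congr rfl fun p _ => ?_
  rw [map_mul, Module.End.mul_apply, shiftAct_single]

/-- Telescoping in the last variable leaves boundary terms at `z + 1` and at `y`. Those at `z + 1`
are wanted, and of those at `y` only the one without deletion inside `init k`. The others have final
arguments `(y + 1, y)`, and the vanishing condition rewrites this value as the special part of the
operator, so that they cancel. -/
theorem sumOp_diffAll (S : Finset (ℤ × ℤ)) (f : S → ℂ) : ∀ (m : ℕ) (k : Fin (m + 1) → ℤ)
    (B : (Fin m → ℤ) → ℂ), B ∈ vanishing (kernelOf (laurentOf S f)) m →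
    sumOp S f m k (shiftAct m (diffAll m) B) =
      ∑ p : Fin (m + 1), (-1) ^ (p : ℕ) * B (deleteShift p k)
  | 0, k, B, _ => by
    simp only [sumOp, diffAll]
    simp [Subsingleton.elim (deleteShift 0 k) Fin.elim0]
  | 1, k, B, _ => by
    simp only [sumOp, diffAll_snoc]
    rw [extSum_telescope _ _ (fun x => shiftAct 0 (diffAll 0)
      (fun l' => B (Fin.snoc (α := fun _ => ℤ) l' x)) Fin.elim0)]
    rw [Fin.sum_univ_two]
    have h0 := deleteShift_castSucc 0 k
    have h1 := deleteShift_last k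
    simp only [Fin.castSucc_zero] at h0
    rw [show (1 : Fin 2) = Fin.last 1 from rfl, h0, h1, ← Fin.snoc_init_self (Fin.init k)]
    simp [diffAll, Subsingleton.elim (Fin.init (Fin.init k)) Fin.elim0, sub_eq_add_neg]
    rfl
  | m + 2, k, B, hB => by
    set y : ℤ := Fin.init k (Fin.last (m + 1)) with hy
    set z : ℤ := k (Fin.last (m + 2)) with hz
    have hsn := fun x => vanishing_snoc hB x
    have hsn2 := fun x x' => vanishing_snoc (vanishing_snoc hB x) x'
    -- The sum over `S` of the mixed second differences of `B` in its last two arguments, as a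
    -- function of the remaining ones.
    set C : (Fin m → ℤ) → ℂ := ∑ p : S, f p • (
      ((fun l' => B (Fin.snoc (α := fun _ => ℤ) (Fin.snoc (α := fun _ => ℤ) l'
          (y + (p : ℤ × ℤ).1 + 1)) (y + (p : ℤ × ℤ).2 + 1)))
        - (fun l' => B (Fin.snoc (α := fun _ => ℤ) (Fin.snoc (α := fun _ => ℤ) l'
          (y + (p : ℤ × ℤ).1)) (y + (p : ℤ × ℤ).2 + 1))))
      - ((fun l' => B (Fin.snoc (α := fun _ => ℤ) (Fin.snoc (α := fun _ => ℤ) l'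
          (y + (p : ℤ × ℤ).1 + 1)) (y + (p : ℤ × ℤ).2)))
        - (fun l' => B (Fin.snoc (α := fun _ => ℤ) (Fin.snoc (α := fun _ => ℤ) l'
          (y + (p : ℤ × ℤ).1)) (y + (p : ℤ × ℤ).2))))) with hC
    have hCV : C ∈ vanishing (kernelOf (laurentOf S f)) m :=
      Submodule.sum_mem _ fun p _ => Submodule.smul_mem _ _
        (Submodule.sub_mem _ (Submodule.sub_mem _ (hsn2 _ _) (hsn2 _ _))
          (Submodule.sub_mem _ (hsn2 _ _) (hsn2 _ _)))
    have hCeq : (fun l' => ∑ p : S, f p * shiftAct (m + 2) (diffAll (m + 2)) B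
          (Fin.snoc (α := fun _ => ℤ)
            (Fin.snoc (α := fun _ => ℤ) l' (y + (p : ℤ × ℤ).1)) (y + (p : ℤ × ℤ).2)))
        = shiftAct m (diffAll m) C := by
      ext l'
      simp only [hC, map_sum, map_smul, map_sub, Finset.sum_apply,
        Pi.smul_apply, Pi.sub_apply, diffAll_snoc, smul_eq_mul]
    have hfin : ∀ l' : Fin m → ℤ, C l' = B (Fin.snoc (α := fun _ => ℤ)
        (Fin.snoc (α := fun _ => ℤ) l' (y + 1)) y) := by
      intro l'
      -- Vanishing for the last adjacent pair, at the point where both arguments equal `y`.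
      have := hB (Fin.last m).castSucc (Fin.last (m + 1)) (by simp)
        (Fin.snoc (α := fun _ => ℤ) (Fin.snoc (α := fun _ => ℤ) l' y) y) (by simp)
      rw [shiftAct_substShift_kernelOf, sub_eq_zero, snoc_add_single_castSucc,
        snoc_add_single_last] at this
      rw [this, hC, Finset.sum_apply]
      refine Finset.sum_congr rfl fun p _ => ?_
      simp only [Pi.smul_apply, Pi.sub_apply, smul_eq_mul, map_mul, map_sub, map_one,
        Module.End.mul_apply, LinearMap.sub_apply, shiftAct_shiftVar, Module.End.one_apply,
        ← add_assoc, snoc_add_single_last, snoc_add_single_castSucc]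
      ring
    rw [sumOp]
    simp only [diffAll_snoc]
    simp only [sumOp_sub S f (m + 1)]
    rw [extSum_telescope _ _ (fun x => sumOp S f (m + 1) (Fin.init k) (fun l' =>
      shiftAct (m + 1) (diffAll (m + 1)) (fun l => B (Fin.snoc (α := fun _ => ℤ) l x)) l'))]
    have e1 : ∀ x, sumOp S f (m + 1) (Fin.init k) (fun l' => shiftAct (m + 1) (diffAll (m + 1))
        (fun l => B (Fin.snoc (α := fun _ => ℤ) l x)) l') = _ :=
      fun x => sumOp_diffAll S f (m + 1) (Fin.init k) _ (hsn x)
    have e2 := sumOp_diffAll S f m (Fin.init (Fin.init k)) C hCV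
    rw [← hCeq] at e2
    simp only [diffAll_snoc] at e2
    simp only [← hy, ← hz] at e2 ⊢
    -- The first splitting isolates the term `B (init k)` of the goal, the second the same term of
    -- the lower boundary sum.
    rw [e1, e1, e2, Fin.sum_univ_castSucc (n := m + 2)]
    rw [Fin.sum_univ_castSucc (f := fun p : Fin (m + 2) => (-1 : ℂ) ^ (p : ℕ) *
      B (Fin.snoc (α := fun _ => ℤ) (deleteShift p (Fin.init k)) y))]
    simp only [deleteShift_castSucc, deleteShift_last, hfin, Fin.val_castSucc, Fin.val_last,
      ← hy, ← hz]
    rw [hy, Fin.snoc_init_self]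
    ring

/-! ### Binomial determinants -/

/-- The determinant of the matrix with entries `binom (k_i, j + c)`, `0 ≤ j < n`. -/
def binDet (n c : ℕ) (k : Fin n → ℤ) : ℂ :=
  Matrix.det (Matrix.of fun i j : Fin n => ((Ring.choose (k i) ((j : ℕ) + c) : ℤ) : ℂ))

theorem factorial_mul_choose (x : ℤ) (j : ℕ) :
    (j.factorial : ℂ) * ((Ring.choose x j : ℤ) : ℂ) = (descPochhammer ℂ j).eval (x : ℂ) := by
  have h := Ring.descPochhammer_eq_factorial_smul_choose x j
  rw [Polynomial.eval_eq_smeval]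
  have h' := congrArg (Int.cast : ℤ → ℂ) h
  rw [nsmul_eq_mul, Int.cast_mul, Int.cast_natCast] at h'
  rw [← h', ← Polynomial.aeval_eq_smeval, ← Polynomial.eval_eq_smeval,
    ← descPochhammer_map (Int.castRingHom ℂ), Polynomial.eval_map]
  simp [Polynomial.aeval_def, Polynomial.eval₂_at_intCast]

/-- Scaling column `j` by `j!` produces falling factorials, which are monic of degree `j`; such a
determinant is Vandermonde. -/
theorem prod_factorial_mul_binDet (n : ℕ) (k : Fin n → ℤ) :
    (∏ j : Fin n, ((j : ℕ).factorial : ℂ)) * binDet n 0 k =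
      ∏ p ∈ univ.filter (fun p : Fin n × Fin n => p.1 < p.2), ((k p.2 : ℂ) - (k p.1 : ℂ)) := by
  have h := Matrix.det_eval_matrixOfPolynomials_eq_det_vandermonde (fun i => (k i : ℂ))
    (fun j : Fin n => descPochhammer ℂ j) (fun j => descPochhammer_natDegree ℂ j)
    (fun j => monic_descPochhammer ℂ j)
  rw [binDet, ← Matrix.det_mul_row, Finset.prod_filter, Fintype.prod_prod_type]
  have h2 : (∏ x : Fin n, ∏ y : Fin n, if x < y then ((k y : ℂ) - (k x : ℂ)) else 1) =
      (Matrix.vandermonde fun i => (k i : ℂ)).det := by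
    rw [Matrix.det_vandermonde]
    refine Finset.prod_congr rfl fun i _ => ?_
    rw [← Finset.prod_filter]
    refine Finset.prod_congr ?_ fun _ _ => rfl
    ext; simp
  rw [h2, h]
  congr 1
  ext i j
  simp [factorial_mul_choose]

theorem binDet_id (n : ℕ) : binDet n 0 (fun i => ((i : ℕ) : ℤ)) = 1 := by
  unfold binDet
  rw [Matrix.det_of_isLowerTriangular]
  · refine Finset.prod_eq_one fun i _ => ?_
    simp [Ring.choose_natCast]
  · intro i j hij
    have : (i : ℕ) < j := hij
    simp [Ring.choose_natCast, Nat.choose_eq_zero_of_lt this]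

theorem gtProduct_eq_binDet (n : ℕ) : gtProduct n = binDet n 0 := by
  funext k
  have h1 := prod_factorial_mul_binDet n k
  -- At `k = (0, …, n - 1)` the determinant is `1`, which identifies the product of the factorials
  -- with that of the denominators `j - i`.
  have h2 := prod_factorial_mul_binDet n (fun i => ((i : ℕ) : ℤ))
  rw [binDet_id, mul_one] at h2
  have h0 : (∏ j : Fin n, ((j : ℕ).factorial : ℂ)) ≠ 0 :=
    Finset.prod_ne_zero_iff.mpr fun j _ => by exact_mod_cast Nat.factorial_ne_zero _
  simp only [Int.cast_natCast] at h2
  rw [gtProduct, Finset.prod_div_distrib, ← h1, ← h2, mul_div_cancel_left₀ _ h0]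

theorem binDet_comp_swap {n : ℕ} (c : ℕ) (k : Fin n → ℤ) {i j : Fin n} (hij : i ≠ j) :
    binDet n c (k ∘ Equiv.swap i j) = - binDet n c k := by
  have := Matrix.det_permute (Equiv.swap i j)
    (Matrix.of fun a b : Fin n => ((Ring.choose (k a) ((b : ℕ) + c) : ℤ) : ℂ))
  rw [Equiv.Perm.sign_swap hij] at this
  simp only [Units.val_neg, Units.val_one, Int.cast_neg, Int.cast_one, neg_mul, one_mul] at this
  exact this

/-- Column zero consists of ones, and deleting it raises the lower binomial index by one. -/
theorem binDet_succ (n : ℕ) (k : Fin (n + 1) → ℤ) :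
    binDet (n + 1) 0 k = ∑ p : Fin (n + 1), (-1) ^ (p : ℕ) *
      binDet n 1 (fun i => k (p.succAbove i)) := by
  rw [binDet, Matrix.det_succ_column_zero]
  refine Finset.sum_congr rfl fun p _ => ?_
  simp [binDet, Matrix.submatrix]

theorem diffAll_prod : ∀ (n : ℕ) (g : Fin n → ℤ → ℂ) (l : Fin n → ℤ),
    shiftAct n (diffAll n) (fun l => ∏ i, g i (l i)) l = ∏ i, (g i (l i + 1) - g i (l i))
  | 0, g, l => by simp [diffAll]
  | n + 1, g, l => by
    have h : ∀ x, (fun l' : Fin n → ℤ => ∏ i, g i (Fin.snoc (α := fun _ => ℤ) l' x i)) =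
        g (Fin.last n) x • fun l' : Fin n → ℤ => ∏ i : Fin n, g i.castSucc (l' i) := by
      intro x
      funext l'
      simp [Fin.prod_univ_castSucc, mul_comm]
    rw [← Fin.snoc_init_self l, diffAll_snoc, h, h]
    simp only [map_smul, Pi.smul_apply, diffAll_prod n, Fin.prod_univ_castSucc (n := n),
      smul_eq_mul, Fin.snoc_castSucc, Fin.snoc_last]
    ring

/-- Each Leibniz term is a product of functions of single variables, so Pascal's rule applies factor
by factor. -/
theorem diffAll_binDet (n : ℕ) : shiftAct n (diffAll n) (binDet n 1) = binDet n 0 := by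
  have h : binDet n 1 = ∑ σ : Equiv.Perm (Fin n), ((Equiv.Perm.sign σ : ℤ) : ℂ) •
      fun l : Fin n → ℤ => ∏ i, ((Ring.choose (l i) ((σ i : ℕ) + 1) : ℤ) : ℂ) := by
    funext l
    simp [binDet, ← Matrix.det_transpose (Matrix.of _), Matrix.det_apply']
  rw [h]
  funext l
  simp only [map_sum, map_smul, Finset.sum_apply, Pi.smul_apply]
  rw [binDet, ← Matrix.det_transpose, Matrix.det_apply']
  refine Finset.sum_congr rfl fun σ _ => ?_
  rw [diffAll_prod n (fun i x => ((Ring.choose x ((σ i : ℕ) + 1) : ℤ) : ℂ)), smul_eq_mul]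
  congr 1
  refine Finset.prod_congr rfl fun i _ => ?_
  simp [Ring.choose_succ_succ]

/-! ### The operator formula for `alpha` -/

/-- The pullback along a map of index sets, on vectors. -/
def pullIndex {m n : ℕ} (e : Fin n → Fin m) : (Fin m → ℤ) →+ (Fin n → ℤ) where
  toFun v := fun i => v (e i)
  map_zero' := rfl
  map_add' _ _ := rfl

theorem shiftAct_pullIndex {m n : ℕ} (e : Fin n → Fin m) (x : ShiftAlg m)
    (G : (Fin n → ℤ) → ℂ) (l : Fin m → ℤ) :
    shiftAct m x (fun l' => G (fun i => l' (e i))) l =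
      shiftAct n (AddMonoidAlgebra.mapDomainAlgHom ℂ ℂ (pullIndex e) x) G (fun i => l (e i)) :=
  shiftAct_mapDomain (pullIndex e) (fun l i => l (e i)) (fun _ _ => rfl) x G l

theorem pullIndex_single {m n : ℕ} {e : Fin n → Fin m} (he : Function.Injective e) (i : Fin n)
    (c : ℤ) : pullIndex e (Pi.single (e i) c) = Pi.single i c := by
  ext j
  simp [pullIndex, Pi.single_apply, he.eq_iff]

theorem pullIndex_single_of_notMem {m n : ℕ} {e : Fin n → Fin m} (s : Fin m) (hs : ∀ i, e i ≠ s)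
    (c : ℤ) : pullIndex e (Pi.single s c) = 0 := by
  ext j
  simp [pullIndex, hs j]

theorem pull_shiftVar_of_notMem {m n : ℕ} {e : Fin n → Fin m} (s : Fin m) (hs : ∀ i, e i ≠ s) :
    AddMonoidAlgebra.mapDomainAlgHom ℂ ℂ (pullIndex e) (shiftVar s) = 1 := by
  simp [shiftVar, pullIndex_single_of_notMem s hs, AddMonoidAlgebra.one_def]

/-- The increasing pairs together with `(j, i)` are stable under exchanging `i` and `j`: these are
neighbours, so no other pair changes its order. -/
theorem pairProd_swap_invariant {n : ℕ} (r : Laurent₂) (i j : Fin n) (hij : (i : ℕ) + 1 = j) :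
    AddMonoidAlgebra.mapDomainAlgHom ℂ ℂ (pullIndex (Equiv.swap i j))
      (substShift j i r * pairProd n r) = substShift j i r * pairProd n r := by
  have hlt : i < j := by rw [Fin.lt_def]; omega
  have h0 : substShift j i r * pairProd n r =
      ∏ p ∈ insert (j, i) (univ.filter (fun p : Fin n × Fin n => p.1 < p.2)),
        substShift p.1 p.2 r := by
    rw [Finset.prod_insert (by simp [hlt.le]), pairProd_eq]
  rw [h0, map_prod]
  refine Finset.prod_nbij' (fun p => (Equiv.swap i j p.1, Equiv.swap i j p.2))
    (fun p => (Equiv.swap i j p.1, Equiv.swap i j p.2)) ?_ ?_ (by simp) (by simp) ?_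
  case refine_3 =>
    intro p _
    have := pullIndex_single (Equiv.swap i j).injective
    refine mapDomainAlgHom_substShift _ _ _ _ _ (fun c => ?_) (fun c => ?_) _
    · simpa using this (Equiv.swap i j p.1) c
    · simpa using this (Equiv.swap i j p.2) c
  all_goals
    rintro ⟨a, b⟩ hab
    simp only [Finset.mem_insert, Prod.mk.injEq, Finset.mem_filter, Finset.mem_univ, true_and,
      Equiv.swap_apply_def, Fin.lt_def, Fin.ext_iff] at hab ⊢
    split_ifs <;> omega

theorem pairProd_binDet_mem_vanishing (n c : ℕ) (r : Laurent₂) :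
    shiftAct n (pairProd n r) (binDet n c) ∈ vanishing r n := by
  intro i j hij l hl
  have hne : i ≠ j := by rintro rfl; omega
  rw [← Module.End.mul_apply, ← map_mul]
  set x := substShift j i r * pairProd n r with hx
  have h1 := shiftAct_pullIndex (Equiv.swap i j) x (binDet n c) l
  rw [pairProd_swap_invariant r i j hij] at h1
  have h2 : (fun l' : Fin n → ℤ => binDet n c fun a => l' (Equiv.swap i j a)) = - binDet n c := by
    funext l'
    exact binDet_comp_swap c l' hne
  have h3 : (fun a => l (Equiv.swap i j a)) = l := by
    funext a
    rw [Equiv.swap_apply_def]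
    split_ifs with h h'
    · rw [h, hl]
    · rw [h', hl]
    · rfl
  rw [h2, h3, map_neg, Pi.neg_apply] at h1
  -- A symmetric operator applied to an antisymmetric function, evaluated at a point fixed by the
  -- swap.
  exact self_eq_neg.mp h1.symm

/-- Setting `E_p = 1` uses only `r(1, Y) = Y`, for pairs starting at `p`, and `r(X, 1) = 1`, for
pairs ending at `p`; the factor `(X - 1) (Y - 1)` kills the arbitrary `s`. -/
theorem pull_pairProd_succAbove {n : ℕ} (s : Laurent₂) (p : Fin (n + 1)) :
    AddMonoidAlgebra.mapDomainAlgHom ℂ ℂ (pullIndex p.succAbove) (pairProd (n + 1) (kernelOf s)) =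
      (∏ t : Fin n, if p < p.succAbove t then shiftVar t else 1) * pairProd n (kernelOf s) := by
  have hp : ∀ i, p.succAbove i ≠ p := fun i => Fin.succAbove_ne p i
  have hv := fun i => mapDomainAlgHom_shiftVar (pullIndex p.succAbove) (p.succAbove i) i
    (pullIndex_single Fin.succAbove_right_injective i 1)
  have hpp := pull_shiftVar_of_notMem p hp
  unfold pairProd
  rw [Fin.prod_univ_succAbove _ p, map_mul, map_prod, map_prod]
  congr 1
  · rw [Fin.prod_univ_succAbove _ p]
    simp only [lt_irrefl, if_false, map_one, one_mul]
    refine Finset.prod_congr rfl fun t _ => ?_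
    split_ifs
    · simp only [kernelOf, map_add, map_mul, map_sub, map_one, substShift_X, substShift_Y, hpp, hv]
      ring
    · simp
  · refine Finset.prod_congr rfl fun a _ => ?_
    rw [Fin.prod_univ_succAbove _ p, map_mul, map_prod]
    have : AddMonoidAlgebra.mapDomainAlgHom ℂ ℂ (pullIndex p.succAbove)
        (if p.succAbove a < p then substShift (p.succAbove a) p (kernelOf s) else 1) = 1 := by
      split_ifs
      · simp only [kernelOf, map_add, map_mul, map_sub, map_one, substShift_X, substShift_Y, hpp]
        ring
      · simp
    rw [this, one_mul]
    refine Finset.prod_congr rfl fun t _ => ?_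
    simp only [Fin.succAbove_lt_succAbove_iff]
    split_ifs
    · exact mapDomainAlgHom_substShift _ _ _ _ _
        (pullIndex_single Fin.succAbove_right_injective a)
        (pullIndex_single Fin.succAbove_right_injective t) _
    · simp

theorem prod_shiftVar {n : ℕ} (P : Fin n → Prop) [DecidablePred P] :
    (∏ t : Fin n, if P t then shiftVar t else 1) =
      (AddMonoidAlgebra.single (fun t => if P t then 1 else 0) 1 : ShiftAlg n) := by
  have h : ∀ A : Finset (Fin n), (∏ t ∈ A, if P t then shiftVar t else 1) =
      (AddMonoidAlgebra.single (∑ t ∈ A, Pi.single t (if P t then 1 else 0)) 1 : ShiftAlg n) := by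
    intro A
    induction A using Finset.induction_on with
    | empty => simp [AddMonoidAlgebra.one_def]
    | insert a A ha ih =>
      rw [Finset.prod_insert ha, Finset.sum_insert ha, ih]
      split_ifs
      · simp [shiftVar, AddMonoidAlgebra.single_mul_single]
      · simp
  rw [h, Finset.univ_sum_single]

theorem shiftAct_pairProd_delete {n : ℕ} (s : Laurent₂) (p : Fin (n + 1)) (G : (Fin n → ℤ) → ℂ)
    (k : Fin (n + 1) → ℤ) :
    shiftAct (n + 1) (pairProd (n + 1) (kernelOf s)) (fun l => G fun i => l (p.succAbove i)) k =
      shiftAct n (pairProd n (kernelOf s)) G (deleteShift p k) := by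
  rw [shiftAct_pullIndex, pull_pairProd_succAbove, prod_shiftVar, map_mul, Module.End.mul_apply,
    shiftAct_single, one_mul]
  refine congrArg _ (funext fun i => ?_)
  have : p < p.succAbove i ↔ ¬ i.castSucc < p := by
    rw [Fin.lt_succAbove_iff_le_castSucc, not_lt]
  simp only [Pi.add_apply, deleteShift, this, ite_not]

theorem prodOperator_gtProduct_eq_alpha (S : Finset (ℤ × ℤ)) (f : S → ℂ) : ∀ n : ℕ,
    prodOperator n (kernelOf (laurentOf S f)) (gtProduct n) = alpha S f n
  | 0 => by
    funext k
    simp [prodOperator_eq, pairProd, alpha, gtProduct]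
  | n + 1 => by
    have ih := prodOperator_gtProduct_eq_alpha S f n
    rw [prodOperator_eq, gtProduct_eq_binDet] at ih ⊢
    funext k
    -- Commutativity pulls the differences in front of the pair product, so that `sumOp_diffAll`
    -- applies.
    rw [alpha, ← ih, ← diffAll_binDet n, ← Module.End.mul_apply, ← map_mul, mul_comm, map_mul,
      Module.End.mul_apply, sumOp_diffAll S f n k _ (pairProd_binDet_mem_vanishing n 1 _)]
    have : binDet (n + 1) 0 = ∑ p : Fin (n + 1), ((-1 : ℂ) ^ (p : ℕ)) •
        fun l : Fin (n + 1) → ℤ => binDet n 1 fun i => l (p.succAbove i) := by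
      funext l
      simp [binDet_succ]
    rw [this]
    simp only [map_sum, map_smul, Finset.sum_apply, Pi.smul_apply, shiftAct_pairProd_delete,
      smul_eq_mul]

/-! ### Two consecutive rows of an `S`-triangle -/

/-- The extension of a finite row by zero. -/
def rowExt {n : ℕ} (k : Fin n → ℤ) (j : ℕ) : ℤ := if h : j < n then k ⟨j, h⟩ else 0

theorem rowExt_val {n : ℕ} (k : Fin n → ℤ) (j : Fin n) : rowExt k j = k j := by
  simp [rowExt]

theorem rowExt_of_lt {n : ℕ} (k : Fin n → ℤ) {j : ℕ} (h : j < n) : rowExt k j = k ⟨j, h⟩ := by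
  simp [rowExt, h]

theorem rowExt_of_le {n : ℕ} (k : Fin n → ℤ) {j : ℕ} (h : n ≤ j) : rowExt k j = 0 := by
  simp [rowExt, h]

theorem rowExt_snoc_self {m : ℕ} (l : Fin m → ℤ) (x : ℤ) :
    rowExt (Fin.snoc (α := fun _ => ℤ) l x) m = x := by
  rw [rowExt_of_lt _ (Nat.lt_succ_self m)]
  exact Fin.snoc_last _ _

theorem rowExt_snoc_of_lt {m : ℕ} (l : Fin m → ℤ) (x : ℤ) {j : ℕ} (h : j < m) :
    rowExt (Fin.snoc (α := fun _ => ℤ) l x) j = rowExt l j := by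
  rw [rowExt_of_lt _ (Nat.lt_succ_of_lt h), rowExt_of_lt _ h]
  exact Fin.snoc_castSucc (α := fun _ => ℤ) x l ⟨j, h⟩

theorem rowExt_init {m : ℕ} (k : Fin (m + 1) → ℤ) {j : ℕ} (h : j < m) :
    rowExt (Fin.init k) j = rowExt k j := by
  rw [rowExt_of_lt _ (Nat.lt_succ_of_lt h), rowExt_of_lt _ h]
  rfl

/-- The integers lying between `x` and `y`, in the sense of the definition of `S`-triangles. -/
def betweenSet (x y : ℤ) : Finset ℤ :=
  if x ≤ y then Finset.Icc x y else Finset.Icc (y + 1) (x - 1)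

theorem mem_betweenSet {x y z : ℤ} : z ∈ betweenSet x y ↔
    (x ≤ y → x ≤ z ∧ z ≤ y) ∧ (x > y → x > z ∧ z > y) := by
  unfold betweenSet
  split_ifs with h <;> simp only [Finset.mem_Icc] <;> omega

/-- The strict inequalities at an inversion describe exactly the range of the reversed sum, and its
minus sign is the weight of the inversion. -/
theorem extSum_eq_sum_betweenSet (x y : ℤ) (g : ℤ → ℂ) :
    extSum x y g = ∑ z : betweenSet x y, (if x > y then -1 else 1) * g z := by
  rw [Finset.sum_coe_sort (betweenSet x y) (fun z => (if x > y then -1 else 1) * g z)]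
  unfold extSum betweenSet
  by_cases h : x ≤ y
  · simp [h, not_lt.mpr h]
  · simp [h, not_le.mp h]

/-- The conditions on a row `b` of length `m` lying above a row `a` of length `m + 1` (both indexed
from `0`), where the entries of `a` at the positions `sp` are special. -/
structure RowCond (S : Finset (ℤ × ℤ)) (m : ℕ) (a b : ℕ → ℤ) (sp : Finset ℕ) : Prop where
  inner : ∀ c ∈ sp, 1 ≤ c ∧ c < m
  not_adjacent : ∀ c ∈ sp, c + 1 ∉ sp
  parents : ∀ c, c + 1 ∈ sp → ∃ s ∈ S, b c = a (c + 1) + s.1 ∧ b (c + 1) = a (c + 1) + s.2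
  between : ∀ j < m, j ∉ sp → j + 1 ∉ sp → b j ∈ betweenSet (a j) (a (j + 1))

theorem RowCond.congr {S : Finset (ℤ × ℤ)} {m : ℕ} {a a' b b' : ℕ → ℤ} {sp : Finset ℕ}
    (ha : ∀ j ≤ m, a j = a' j) (hb : ∀ j < m, b j = b' j) (h : RowCond S m a b sp) :
    RowCond S m a' b' sp where
  inner := h.inner
  not_adjacent := h.not_adjacent
  parents c hc := by
    have := h.inner _ hc
    rw [← ha _ this.2.le, ← hb _ this.2, ← hb _ (by omega)]
    exact h.parents c hc
  between j hj h1 h2 := by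
    rw [← ha _ hj.le, ← ha _ hj, ← hb _ hj]
    exact h.between j hj h1 h2

theorem rowCond_succ_iff {S : Finset (ℤ × ℤ)} {m : ℕ} {a b : ℕ → ℤ} {sp : Finset ℕ}
    (hm : m ∉ sp) : RowCond S (m + 1) a b sp ↔
      RowCond S m a b sp ∧ b m ∈ betweenSet (a m) (a (m + 1)) := by
  constructor
  · intro h
    have hm1 : m + 1 ∉ sp := fun h' => by have := h.inner _ h'; omega
    refine ⟨⟨fun c hc => ?_, h.not_adjacent, h.parents, fun j hj => h.between j (by omega)⟩,
      h.between m (by omega) hm hm1⟩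
    have := h.inner c hc
    have : c ≠ m := fun e => hm (e ▸ hc)
    omega
  · rintro ⟨h, hb⟩
    refine ⟨fun c hc => ?_, h.not_adjacent, h.parents, fun j hj h1 h2 => ?_⟩
    · have := h.inner c hc
      omega
    · rcases Nat.lt_succ_iff_lt_or_eq.mp hj with hj | rfl
      · exact h.between j hj h1 h2
      · exact hb

/-- A special entry at `m + 1` fixes the last two entries of the upper row and, by non-adjacency,
forbids one at `m`. Hence the recursion drops two entries of each row. -/
theorem rowCond_insert_iff {S : Finset (ℤ × ℤ)} {m : ℕ} {a b : ℕ → ℤ} {sp : Finset ℕ}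
    (hm : m + 1 ∉ sp) : RowCond S (m + 2) a b (insert (m + 1) sp) ↔
      RowCond S m a b sp ∧ ∃ s ∈ S, b m = a (m + 1) + s.1 ∧ b (m + 1) = a (m + 1) + s.2 := by
  constructor
  · intro h
    refine ⟨⟨fun c hc => ?_, fun c hc hc' => ?_, fun c hc => h.parents c (by simp [hc]),
      fun j hj h1 h2 => h.between j (by omega) ?_ ?_⟩, h.parents m (by simp)⟩
    · have h1 := h.inner c (by simp [hc])
      have h2 : c ≠ m + 1 := fun e => hm (e ▸ hc)
      have h3 : c ≠ m := fun e => h.not_adjacent c (by simp [hc]) (by simp [e])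
      omega
    · exact h.not_adjacent c (by simp [hc]) (by simp [hc'])
    · simp only [Finset.mem_insert, not_or]; exact ⟨by omega, h1⟩
    · simp only [Finset.mem_insert, not_or]; exact ⟨by omega, h2⟩
  · rintro ⟨h, hs⟩
    refine ⟨fun c hc => ?_, fun c hc hc' => ?_, fun c hc => ?_, fun j hj h1 h2 => ?_⟩
    · rcases Finset.mem_insert.mp hc with rfl | hc
      · omega
      · have := h.inner c hc; omega
    · rcases Finset.mem_insert.mp hc with rfl | hc <;>
        rcases Finset.mem_insert.mp hc' with hc' | hc'
      · omega
      · have := h.inner _ hc'; omega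
      · have := h.inner _ hc; omega
      · exact h.not_adjacent c hc hc'
    · rcases Finset.mem_insert.mp hc with hc | hc
      · obtain rfl : c = m := by omega
        exact hs
      · exact h.parents c hc
    · simp only [Finset.mem_insert, not_or] at h1 h2
      exact h.between j (by omega) h1.2 h2.2

/-- The sign contributed by the inversions in the row `a`. -/
def rowSign (m : ℕ) (a : ℕ → ℤ) (sp : Finset ℕ) : ℂ :=
  ∏ j ∈ range m, if j ∉ sp ∧ j + 1 ∉ sp ∧ a j > a (j + 1) then -1 else 1

/-- The contribution of the special entries in the row `a`. -/
def rowSpecial {S : Finset (ℤ × ℤ)} (f : S → ℂ) (a b : ℕ → ℤ) (sp : Finset ℕ) : ℂ :=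
  ∏ c ∈ sp, ∏ s : S,
    if b (c - 1) = a c + (s : ℤ × ℤ).1 ∧ b c = a c + (s : ℤ × ℤ).2 then f s else 1

/-- The contribution of the row `a` to the weight. -/
def rowWeight {S : Finset (ℤ × ℤ)} (f : S → ℂ) (m : ℕ) (a b : ℕ → ℤ) (sp : Finset ℕ) : ℂ :=
  rowSign m a sp * rowSpecial f a b sp

theorem rowWeight_congr {S : Finset (ℤ × ℤ)} (f : S → ℂ) {m : ℕ} {a a' b b' : ℕ → ℤ}
    {sp : Finset ℕ} (hsp : ∀ c ∈ sp, 1 ≤ c ∧ c < m)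
    (ha : ∀ j ≤ m, a j = a' j) (hb : ∀ j < m, b j = b' j) :
    rowWeight f m a b sp = rowWeight f m a' b' sp := by
  unfold rowWeight rowSign rowSpecial
  congr 1
  · refine Finset.prod_congr rfl fun j hj => ?_
    rw [Finset.mem_range] at hj
    rw [ha j hj.le, ha (j + 1) hj]
  · refine Finset.prod_congr rfl fun c hc => ?_
    have := hsp c hc
    rw [ha c (by omega), hb c (by omega), hb (c - 1) (by omega)]

theorem rowWeight_succ {S : Finset (ℤ × ℤ)} (f : S → ℂ) {m : ℕ} {a b : ℕ → ℤ}
    {sp : Finset ℕ} (hsp : ∀ c ∈ sp, 1 ≤ c ∧ c < m) :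
    rowWeight f (m + 1) a b sp = (if a m > a (m + 1) then -1 else 1) * rowWeight f m a b sp := by
  have h1 : m ∉ sp := fun h => by have := hsp _ h; omega
  have h2 : m + 1 ∉ sp := fun h => by have := hsp _ h; omega
  unfold rowWeight rowSign
  rw [Finset.prod_range_succ]
  simp only [h1, h2, not_false_eq_true, true_and]
  ring

theorem rowWeight_insert {S : Finset (ℤ × ℤ)} (f : S → ℂ) {m : ℕ} {a b : ℕ → ℤ}
    {sp : Finset ℕ} (hsp : ∀ c ∈ sp, 1 ≤ c ∧ c < m) (s : S)
    (h1 : b m = a (m + 1) + (s : ℤ × ℤ).1) (h2 : b (m + 1) = a (m + 1) + (s : ℤ × ℤ).2) :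
    rowWeight f (m + 2) a b (insert (m + 1) sp) = f s * rowWeight f m a b sp := by
  have hm1 : m + 1 ∉ sp := fun h => by have := hsp _ h; omega
  have hs : rowSign (m + 2) a (insert (m + 1) sp) = rowSign m a sp := by
    unfold rowSign
    rw [Finset.prod_range_succ, Finset.prod_range_succ, if_neg (by simp), if_neg (by simp),
      mul_one, mul_one]
    refine Finset.prod_congr rfl fun j hj => ?_
    rw [Finset.mem_range] at hj
    have e1 : j ∈ insert (m + 1) sp ↔ j ∈ sp := by
      rw [Finset.mem_insert]; constructor
      · rintro (h | h)
        · omega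
        · exact h
      · exact Or.inr
    have e2 : j + 1 ∈ insert (m + 1) sp ↔ j + 1 ∈ sp := by
      rw [Finset.mem_insert]; constructor
      · rintro (h | h)
        · omega
        · exact h
      · exact Or.inr
    simp only [e1, e2]
  unfold rowWeight
  rw [hs]
  unfold rowSpecial
  rw [Finset.prod_insert hm1]
  -- The parents determine the associated element of `S`, so a single factor differs from `1`.
  have : (∏ s' : S, if b (m + 1 - 1) = a (m + 1) + (s' : ℤ × ℤ).1 ∧
      b (m + 1) = a (m + 1) + (s' : ℤ × ℤ).2 then f s' else 1) = f s := by
    rw [Finset.prod_eq_single s]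
    · rw [if_pos ⟨h1, h2⟩]
    · intro s' _ hne
      rw [if_neg]
      rintro ⟨h3, h4⟩
      refine hne (Subtype.ext (Prod.ext ?_ ?_))
      · rw [Nat.add_sub_cancel] at h3; omega
      · omega
    · simp
  rw [this]
  ring

/-- The possible rows above a given row `k`, together with the special entries of `k`. -/
def RowChoice (S : Finset (ℤ × ℤ)) (m : ℕ) (k : Fin (m + 1) → ℤ) : Type :=
  {x : (Fin m → ℤ) × Finset ℕ // RowCond S m (rowExt k) (rowExt x.1) x.2}

/-- Append a non-parent to the upper row. -/
def RowChoice.snoc {S : Finset (ℤ × ℤ)} {m : ℕ} {k : Fin (m + 2) → ℤ}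
    (z : betweenSet (Fin.init k (Fin.last m)) (k (Fin.last (m + 1))))
    (x : RowChoice S m (Fin.init k)) : RowChoice S (m + 1) k :=
  ⟨(Fin.snoc (α := fun _ => ℤ) x.1.1 z, x.1.2), by
    have hx := x.2
    rw [rowCond_succ_iff (fun h => by have := hx.inner _ h; omega)]
    refine ⟨hx.congr (fun j hj => rowExt_init k (by omega))
      fun j hj => (rowExt_snoc_of_lt _ _ hj).symm, ?_⟩
    rw [rowExt_snoc_self, rowExt_of_lt k (show m < m + 2 by omega),
      rowExt_of_lt k (show m + 1 < m + 2 by omega)]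
    exact z.2⟩

/-- Append the two parents of a special entry to the upper row. -/
def RowChoice.snocParents {S : Finset (ℤ × ℤ)} {m : ℕ} {k : Fin (m + 3) → ℤ} (s : S)
    (x : RowChoice S m (Fin.init (Fin.init k))) : RowChoice S (m + 2) k :=
  ⟨(Fin.snoc (α := fun _ => ℤ) (Fin.snoc (α := fun _ => ℤ) x.1.1
      (Fin.init k (Fin.last (m + 1)) + (s : ℤ × ℤ).1))
      (Fin.init k (Fin.last (m + 1)) + (s : ℤ × ℤ).2), insert (m + 1) x.1.2), by
    have hx := x.2
    rw [rowCond_insert_iff (fun h => by have := hx.inner _ h; omega)]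
    refine ⟨hx.congr (fun j hj => ?_) fun j hj => ?_, s, s.2, ?_, ?_⟩
    · rw [rowExt_init _ (by omega), rowExt_init _ (by omega)]
    · rw [rowExt_snoc_of_lt _ _ (by omega), rowExt_snoc_of_lt _ _ hj]
    · rw [rowExt_snoc_of_lt _ _ (by omega), rowExt_snoc_self,
        rowExt_of_lt k (show m + 1 < m + 3 by omega)]
      rfl
    · rw [rowExt_snoc_self, rowExt_of_lt k (show m + 1 < m + 3 by omega)]
      rfl⟩

theorem RowChoice.snoc_surjective {S : Finset (ℤ × ℤ)} {m : ℕ} {k : Fin (m + 2) → ℤ}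
    (x : RowChoice S (m + 1) k) (hx : m ∉ x.1.2) : ∃ z x', x = RowChoice.snoc z x' := by
  obtain ⟨⟨l, sp⟩, h⟩ := x
  change m ∉ sp at hx
  rw [rowCond_succ_iff hx] at h
  have h2 := h.2
  rw [rowExt_of_lt l (Nat.lt_succ_self m), rowExt_of_lt k (show m < m + 2 by omega),
    rowExt_of_lt k (show m + 1 < m + 2 by omega)] at h2
  refine ⟨⟨l (Fin.last m), h2⟩, ⟨(Fin.init l, sp), h.1.congr
    (fun j hj => (rowExt_init k (by omega)).symm) fun j hj => (rowExt_init l hj).symm⟩, ?_⟩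
  apply Subtype.ext
  simp [RowChoice.snoc]

theorem RowChoice.snocParents_surjective {S : Finset (ℤ × ℤ)} {m : ℕ} {k : Fin (m + 3) → ℤ}
    (x : RowChoice S (m + 2) k) (hx : m + 1 ∈ x.1.2) :
    ∃ s x', x = RowChoice.snocParents s x' := by
  obtain ⟨⟨l, sp⟩, h⟩ := x
  change m + 1 ∈ sp at hx
  change RowCond S (m + 2) (rowExt k) (rowExt l) sp at h
  rw [← Finset.insert_erase hx, rowCond_insert_iff (by simp)] at h
  obtain ⟨h, s, hs, h1, h2⟩ := h
  refine ⟨⟨s, hs⟩, ⟨(Fin.init (Fin.init l), sp.erase (m + 1)), h.congr (fun j hj => ?_)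
    fun j hj => ?_⟩, ?_⟩
  · rw [rowExt_init _ (by omega), rowExt_init _ (by omega)]
  · rw [rowExt_init _ (by omega), rowExt_init _ (by omega)]
  · apply Subtype.ext
    rw [rowExt_of_lt l (show m < m + 2 by omega),
      rowExt_of_lt k (show m + 1 < m + 3 by omega)] at h1
    rw [rowExt_of_lt l (show m + 1 < m + 2 by omega),
      rowExt_of_lt k (show m + 1 < m + 3 by omega)] at h2
    refine Prod.ext ?_ (by simp [RowChoice.snocParents, Finset.insert_erase hx])
    have e1 : Fin.init k (Fin.last (m + 1)) + s.1 = Fin.init l (Fin.last m) := h1.symm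
    have e2 : Fin.init k (Fin.last (m + 1)) + s.2 = l (Fin.last (m + 1)) := h2.symm
    simp only [RowChoice.snocParents]
    rw [e1, e2, Fin.snoc_init_self, Fin.snoc_init_self]

theorem RowChoice.snoc_injective {S : Finset (ℤ × ℤ)} {m : ℕ} {k : Fin (m + 2) → ℤ}
    {z z'} {x x' : RowChoice S m (Fin.init k)}
    (h : RowChoice.snoc z x = RowChoice.snoc (k := k) z' x') : z = z' ∧ x = x' := by
  have h := congrArg Subtype.val h
  simp only [RowChoice.snoc, Prod.mk.injEq, Fin.snoc_inj] at h
  exact ⟨Subtype.ext h.1.2, Subtype.ext (Prod.ext h.1.1 h.2)⟩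

theorem RowChoice.snocParents_injective {S : Finset (ℤ × ℤ)} {m : ℕ} {k : Fin (m + 3) → ℤ}
    {s s'} {x x' : RowChoice S m (Fin.init (Fin.init k))}
    (h : RowChoice.snocParents s x = RowChoice.snocParents (k := k) s' x') :
    s = s' ∧ x = x' := by
  have h := congrArg Subtype.val h
  have n1 : m + 1 ∉ x.1.2 := fun h => by have := x.2.inner _ h; omega
  have n2 : m + 1 ∉ x'.1.2 := fun h => by have := x'.2.inner _ h; omega
  simp only [RowChoice.snocParents, Prod.mk.injEq, Fin.snoc_inj, add_right_inj] at h
  refine ⟨Subtype.ext (Prod.ext h.1.1.2 h.1.2), Subtype.ext (Prod.ext h.1.1.1 ?_)⟩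
  rw [← Finset.erase_insert n1, h.2, Finset.erase_insert n2]

/-- The two cases, the last inner position being special or not, mirror the two summands of `sumOp`.
-/
theorem RowChoice.bijective_sumElim {S : Finset (ℤ × ℤ)} {m : ℕ} (k : Fin (m + 3) → ℤ) :
    Function.Bijective (Sum.elim (fun p => RowChoice.snoc p.1 p.2)
      (fun p => RowChoice.snocParents p.1 p.2) :
      (betweenSet (Fin.init k (Fin.last (m + 1))) (k (Fin.last (m + 2))) ×
        RowChoice S (m + 1) (Fin.init k)) ⊕ (S × RowChoice S m (Fin.init (Fin.init k))) →
        RowChoice S (m + 2) k) := by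
  have hne : ∀ (z) (x : RowChoice S (m + 1) (Fin.init k)) (s)
      (x' : RowChoice S m (Fin.init (Fin.init k))),
      RowChoice.snoc (k := k) z x ≠ RowChoice.snocParents s x' := by
    intro z x s x' h
    have h := congrArg (fun u => u.1.2) h
    have h' : x.1.2 = insert (m + 1) x'.1.2 := h
    have := x.2.inner (m + 1) (by simp [h'])
    omega
  constructor
  · rintro (⟨z, x⟩ | ⟨s, x⟩) (⟨z', x'⟩ | ⟨s', x'⟩) h
    · obtain ⟨rfl, rfl⟩ := RowChoice.snoc_injective h; rfl
    · exact (hne _ _ _ _ h).elim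
    · exact (hne _ _ _ _ h.symm).elim
    · obtain ⟨rfl, rfl⟩ := RowChoice.snocParents_injective h; rfl
  · intro x
    by_cases hx : m + 1 ∈ x.1.2
    · obtain ⟨s, x', rfl⟩ := x.snocParents_surjective hx
      exact ⟨Sum.inr (s, x'), rfl⟩
    · obtain ⟨z, x', rfl⟩ := x.snoc_surjective hx
      exact ⟨Sum.inl (z, x'), rfl⟩

/-- The contribution of a row to the weight. -/
def RowChoice.weight {S : Finset (ℤ × ℤ)} (f : S → ℂ) {m : ℕ} {k : Fin (m + 1) → ℤ}
    (x : RowChoice S m k) : ℂ := rowWeight f m (rowExt k) (rowExt x.1.1) x.1.2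

theorem RowChoice.weight_snoc {S : Finset (ℤ × ℤ)} (f : S → ℂ) {m : ℕ} {k : Fin (m + 2) → ℤ}
    (z) (x : RowChoice S m (Fin.init k)) : (RowChoice.snoc (k := k) z x).weight f =
      (if Fin.init k (Fin.last m) > k (Fin.last (m + 1)) then -1 else 1) * x.weight f := by
  unfold RowChoice.weight
  have hx := x.2.inner
  change rowWeight f (m + 1) (rowExt k) (rowExt (Fin.snoc (α := fun _ => ℤ) x.1.1 z)) x.1.2 = _
  rw [rowWeight_succ f hx, rowExt_of_lt k (show m < m + 2 by omega),
    rowExt_of_lt k (show m + 1 < m + 2 by omega)]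
  congr 1
  exact rowWeight_congr f hx (fun j hj => (rowExt_init k (by omega)).symm)
    fun j hj => rowExt_snoc_of_lt _ _ hj

theorem RowChoice.weight_snocParents {S : Finset (ℤ × ℤ)} (f : S → ℂ) {m : ℕ}
    {k : Fin (m + 3) → ℤ} (s : S) (x : RowChoice S m (Fin.init (Fin.init k))) :
    (RowChoice.snocParents (k := k) s x).weight f = f s * x.weight f := by
  unfold RowChoice.weight
  have hx := x.2.inner
  have hk : rowExt k (m + 1) = Fin.init k (Fin.last (m + 1)) :=
    rowExt_of_lt k (show m + 1 < m + 3 by omega)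
  simp only [RowChoice.snocParents]
  rw [rowWeight_insert f hx s]
  · congr 1
    refine rowWeight_congr f hx (fun j hj => ?_) fun j hj => ?_
    · rw [rowExt_init _ (by omega), rowExt_init _ (by omega)]
    · rw [rowExt_snoc_of_lt _ _ (by omega), rowExt_snoc_of_lt _ _ hj]
  · rw [rowExt_snoc_of_lt _ _ (by omega), rowExt_snoc_self, hk]
  · rw [rowExt_snoc_self, hk]

theorem rowChoice_subsingleton_zero {S : Finset (ℤ × ℤ)} {k : Fin 1 → ℤ} (x : RowChoice S 0 k) :
    x.1 = (Fin.elim0, ∅) :=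
  Prod.ext (Subsingleton.elim _ _) (Finset.eq_empty_of_forall_notMem fun c hc => by
    have := x.2.inner c hc
    omega)

/-- The only choice above a row of length one. -/
instance RowChoice.uniqueZero (S : Finset (ℤ × ℤ)) (k : Fin 1 → ℤ) : Unique (RowChoice S 0 k) where
  default := ⟨(Fin.elim0, ∅), by constructor <;> simp⟩
  uniq x := Subtype.ext (rowChoice_subsingleton_zero x)

/-- The summation operator is a weighted sum over all possible rows above the given one. -/
theorem exists_sum_rowChoice (S : Finset (ℤ × ℤ)) (f : S → ℂ) : ∀ (m : ℕ) (k : Fin (m + 1) → ℤ),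
    ∃ _ : Fintype (RowChoice S m k), ∀ A : (Fin m → ℤ) → ℂ,
      ∑ x : RowChoice S m k, x.weight f * A x.1.1 = sumOp S f m k A
  | 0, k => by
    refine ⟨inferInstance, fun A => ?_⟩
    rw [Fintype.sum_unique, rowChoice_subsingleton_zero]
    simp [RowChoice.weight, rowWeight, rowSign, rowSpecial, rowChoice_subsingleton_zero, sumOp]
  | 1, k => by
    obtain ⟨_, h⟩ := exists_sum_rowChoice S f 0 (Fin.init k)
    have hb : Function.Bijective (fun p => RowChoice.snoc p.1 p.2 :
        betweenSet (Fin.init k (Fin.last 0)) (k (Fin.last 1)) × RowChoice S 0 (Fin.init k) →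
          RowChoice S 1 k) := by
      constructor
      · rintro ⟨z, x⟩ ⟨z', x'⟩ h
        obtain ⟨rfl, rfl⟩ := RowChoice.snoc_injective h; rfl
      · intro x
        -- A row of length two has no inner position, so nothing can be special.
        obtain ⟨z, x', rfl⟩ := x.snoc_surjective fun h => by have := x.2.inner _ h; omega
        exact ⟨(z, x'), rfl⟩
    refine ⟨Fintype.ofBijective _ hb, fun A => ?_⟩
    let _ := Fintype.ofBijective _ hb
    rw [sumOp, extSum_eq_sum_betweenSet, ← hb.sum_comp, Fintype.sum_prod_type]
    refine Finset.sum_congr rfl fun z _ => ?_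
    simp only [RowChoice.weight_snoc, mul_assoc, ← Finset.mul_sum]
    exact congrArg _ (h fun l' => A (Fin.snoc (α := fun _ => ℤ) l' z))
  | m + 2, k => by
    obtain ⟨_, h1⟩ := exists_sum_rowChoice S f (m + 1) (Fin.init k)
    obtain ⟨_, h0⟩ := exists_sum_rowChoice S f m (Fin.init (Fin.init k))
    have hb := RowChoice.bijective_sumElim (S := S) k
    refine ⟨Fintype.ofBijective _ hb, fun A => ?_⟩
    let _ := Fintype.ofBijective _ hb
    rw [sumOp, extSum_eq_sum_betweenSet, ← hb.sum_comp, Fintype.sum_sum_type,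
      Fintype.sum_prod_type, Fintype.sum_prod_type_right]
    simp only [Sum.elim_inl, Sum.elim_inr]
    congr 1
    · refine Finset.sum_congr rfl fun z _ => ?_
      simp only [RowChoice.weight_snoc, mul_assoc, ← Finset.mul_sum]
      exact congrArg _ (h1 fun l' => A (Fin.snoc (α := fun _ => ℤ) l' z))
    · rw [← h0]
      refine Finset.sum_congr rfl fun x _ => ?_
      rw [Finset.mul_sum]
      refine Finset.sum_congr rfl fun s _ => ?_
      rw [RowChoice.weight_snocParents]
      simp only [RowChoice.snocParents]
      ring

/-! ### Decomposition of `S`-triangles -/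

theorem isParent_succ_iff {special : Finset (ℕ × ℕ)} {i j : ℕ} :
    IsParent special (i + 1) (j + 1) ↔ (i, j) ∈ special ∨ (i, j + 1) ∈ special := by
  unfold IsParent
  constructor
  · rintro ⟨⟨a, b⟩, hp, h | h⟩
    · simp only [Prod.mk.injEq] at h
      obtain ⟨h1, h2⟩ := h
      obtain rfl : i = a := by omega
      subst h2
      exact Or.inr hp
    · simp only [Prod.mk.injEq] at h
      obtain ⟨h1, h2⟩ := h
      obtain rfl : i = a := by omega
      obtain rfl : j = b := by omega
      exact Or.inl hp
  · rintro (h | h)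
    · exact ⟨_, h, Or.inr rfl⟩
    · exact ⟨_, h, Or.inl rfl⟩

/-- The array obtained by putting the row `a` below the array `e`. -/
def glueEntry (a : ℕ → ℤ) (e : ℕ → ℕ → ℤ) : ℕ → ℕ → ℤ
  | 1, j + 1 => a j
  | i + 2, j + 1 => e (i + 1) j
  | _, _ => 0

/-- The embedding of the positions of the upper `m` rows. -/
def raise (p : ℕ × ℕ) : ℕ × ℕ := (p.1 + 1, p.2 + 1)

theorem raise_injective : Function.Injective raise := by
  rintro ⟨a, b⟩ ⟨c, d⟩ h
  simpa [raise] using h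

/-- The embedding of the positions of the bottom row. -/
def bottom (c : ℕ) : ℕ × ℕ := (1, c + 1)

theorem bottom_injective : Function.Injective bottom := by
  intro a b h
  simpa [bottom] using h

/-- The special positions of the glued array. -/
def glueSpecial (sp : Finset ℕ) (special : Finset (ℕ × ℕ)) : Finset (ℕ × ℕ) :=
  sp.image bottom ∪ special.image raise

/-- The hypothesis excludes marked positions in row zero, which `raise` would send into the bottom
row. -/
theorem mem_glueSpecial_bottom {sp : Finset ℕ} {special : Finset (ℕ × ℕ)}
    (h : ∀ i j, (i, j) ∈ special → 1 ≤ i) {j : ℕ} :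
    (1, j + 1) ∈ glueSpecial sp special ↔ j ∈ sp := by
  simp only [glueSpecial, Finset.mem_union, Finset.mem_image, bottom, raise, Prod.mk.injEq,
    Prod.exists]
  constructor
  · rintro (⟨a, ha, _, h2⟩ | ⟨a, b, hab, h1, _⟩)
    · obtain rfl : a = j := by omega
      exact ha
    · have := h a b hab; omega
  · exact fun hj => Or.inl ⟨j, hj, trivial, rfl⟩

theorem mem_glueSpecial_raise {sp : Finset ℕ} {special : Finset (ℕ × ℕ)} {i j : ℕ} :
    (i + 2, j + 1) ∈ glueSpecial sp special ↔ (i + 1, j) ∈ special := by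
  simp only [glueSpecial, Finset.mem_union, Finset.mem_image, bottom, raise, Prod.mk.injEq,
    Prod.exists]
  constructor
  · rintro (⟨a, ha, h1, _⟩ | ⟨a, b, hab, h1, h2⟩)
    · omega
    · obtain rfl : a = i + 1 := by omega
      obtain rfl : b = j := by omega
      exact hab
  · exact fun hj => Or.inr ⟨_, _, hj, rfl, rfl⟩

theorem glueSpecial_cases {sp : Finset ℕ} {special : Finset (ℕ × ℕ)}
    (h : ∀ i j, (i, j) ∈ special → 1 ≤ i) {i j : ℕ} (hij : (i, j) ∈ glueSpecial sp special) :
    (∃ c ∈ sp, i = 1 ∧ j = c + 1) ∨ ∃ a b, (a + 1, b) ∈ special ∧ i = a + 2 ∧ j = b + 1 := by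
  simp only [glueSpecial, Finset.mem_union, Finset.mem_image, bottom, raise, Prod.mk.injEq,
    Prod.exists] at hij
  rcases hij with ⟨c, hc, h1, h2⟩ | ⟨a, b, hab, h1, h2⟩
  · exact Or.inl ⟨c, hc, h1.symm, h2.symm⟩
  · obtain ⟨a, rfl⟩ := Nat.exists_eq_add_of_le' (h a b hab)
    exact Or.inr ⟨a, b, hab, h1.symm, h2.symm⟩

namespace STriangle

variable {S : Finset (ℤ × ℤ)} {m : ℕ}

theorem one_le_of_mem_special {n : ℕ} (T : STriangle S n) (i j : ℕ) (h : (i, j) ∈ T.special) :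
    1 ≤ i := (T.special_inner i j h).1

theorem entry_zero_left {n : ℕ} (T : STriangle S n) (j : ℕ) : T.entry 0 j = 0 :=
  T.entry_outside _ _ (by omega)

theorem HasBottomRow.entry_eq {n : ℕ} {T : STriangle S n} {k : Fin n → ℤ}
    (h : T.HasBottomRow k) (j : ℕ) : T.entry 1 (j + 1) = rowExt k j := by
  by_cases hj : j < n
  · rw [rowExt_of_lt k hj, ← h ⟨j, hj⟩]
  · rw [rowExt_of_le k (not_lt.mp hj), T.entry_outside _ _ (by omega)]

theorem between_mem {n : ℕ} (T : STriangle S n) {i j : ℕ} (h1 : 1 ≤ i) (h2 : i ≤ j) (h3 : j < n)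
    (h4 : ¬ IsParent T.special (i + 1) (j + 1)) :
    T.entry (i + 1) (j + 1) ∈ betweenSet (T.entry i j) (T.entry i (j + 1)) :=
  mem_betweenSet.mpr ⟨T.between_of_le i j h1 h2 h3 h4, T.between_of_gt i j h1 h2 h3 h4⟩

theorem glue_between {k : Fin (m + 1) → ℤ} {b : Fin m → ℤ} {sp : Finset ℕ}
    (h : RowCond S m (rowExt k) (rowExt b) sp) (T : STriangle S m) (hT : T.HasBottomRow b)
    {i j : ℕ} (h1 : 1 ≤ i) (h2 : i ≤ j) (h3 : j < m + 1)
    (h4 : ¬ IsParent (glueSpecial sp T.special) (i + 1) (j + 1)) :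
    glueEntry (rowExt k) T.entry (i + 1) (j + 1) ∈
      betweenSet (glueEntry (rowExt k) T.entry i j) (glueEntry (rowExt k) T.entry i (j + 1)) := by
  obtain ⟨j, rfl⟩ := Nat.exists_eq_add_of_le' (h1.trans h2)
  rw [isParent_succ_iff, not_or] at h4
  obtain rfl | ⟨i, rfl⟩ : i = 1 ∨ ∃ i', i = i' + 2 := by
    rcases i with _ | _ | i
    · omega
    · exact Or.inl rfl
    · exact Or.inr ⟨i, rfl⟩
  · rw [mem_glueSpecial_bottom T.one_le_of_mem_special,
      mem_glueSpecial_bottom T.one_le_of_mem_special] at h4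
    have := h.between j (by omega) h4.1 h4.2
    rw [← hT.entry_eq] at this
    exact this
  · rw [mem_glueSpecial_raise, mem_glueSpecial_raise] at h4
    exact T.between_mem (i := i + 1) (j := j) (by omega) (by omega) (by omega)
      (by rw [isParent_succ_iff, not_or]; exact h4)

/-- The triangle obtained by putting the row `k` below a triangle. -/
def glue {k : Fin (m + 1) → ℤ} {b : Fin m → ℤ} {sp : Finset ℕ}
    (h : RowCond S m (rowExt k) (rowExt b) sp) (T : STriangle S m) (hT : T.HasBottomRow b) :
    STriangle S (m + 1) where
  entry := glueEntry (rowExt k) T.entry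
  entry_outside i j hij := by
    rcases i with _ | _ | i <;> rcases j with _ | j <;> try rfl
    · exact rowExt_of_le k (by omega)
    · exact T.entry_outside _ _ (by omega)
  special := glueSpecial sp T.special
  special_inner i j hij := by
    rcases glueSpecial_cases T.one_le_of_mem_special hij with
      ⟨c, hc, rfl, rfl⟩ | ⟨i, j, hij', rfl, rfl⟩
    · have := h.inner c hc
      omega
    · have := T.special_inner _ _ hij'
      omega
  special_not_adjacent i j hij := by
    rcases glueSpecial_cases T.one_le_of_mem_special hij with
      ⟨c, hc, rfl, rfl⟩ | ⟨i, j, hij', rfl, rfl⟩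
    · rw [mem_glueSpecial_bottom T.one_le_of_mem_special]
      exact h.not_adjacent c hc
    · rw [mem_glueSpecial_raise]
      exact T.special_not_adjacent _ _ hij'
  special_parents i j hij := by
    rcases glueSpecial_cases T.one_le_of_mem_special hij with
      ⟨c, hc, rfl, rfl⟩ | ⟨i, j, hij', rfl, rfl⟩
    · obtain ⟨c, rfl⟩ := Nat.exists_eq_add_of_le' (h.inner c hc).1
      obtain ⟨s, hs, h1, h2⟩ := h.parents c hc
      rw [← hT.entry_eq] at h1 h2
      exact ⟨s, hs, Prod.ext h1 h2⟩
    · exact T.special_parents _ _ hij'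
  between_of_le _ _ h1 h2 h3 h4 :=
    (mem_betweenSet.mp (glue_between h T hT h1 h2 h3 h4)).1
  between_of_gt _ _ h1 h2 h3 h4 :=
    (mem_betweenSet.mp (glue_between h T hT h1 h2 h3 h4)).2

theorem glue_hasBottomRow {k : Fin (m + 1) → ℤ} {b : Fin m → ℤ} {sp : Finset ℕ}
    (h : RowCond S m (rowExt k) (rowExt b) sp) (T : STriangle S m) (hT : T.HasBottomRow b) :
    (glue h T hT).HasBottomRow k := fun j => rowExt_val k j

theorem tail_between (T : STriangle S (m + 1)) {i j : ℕ} (h1 : 1 ≤ i) (h2 : i ≤ j) (h3 : j < m)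
    (h4 : ¬ IsParent ((T.special.preimage raise raise_injective.injOn).filter fun p => 1 ≤ p.1)
      (i + 1) (j + 1)) :
    T.entry (i + 2) (j + 2) ∈ betweenSet (T.entry (i + 1) (j + 1)) (T.entry (i + 1) (j + 2)) := by
  refine T.between_mem (by omega) (by omega) (by omega) ?_
  rw [isParent_succ_iff] at h4 ⊢
  simpa [raise, h1] using h4

/-- The triangle without its bottom row. -/
def tail (T : STriangle S (m + 1)) : STriangle S m where
  -- Row zero must be `0`, but the index shift alone would place the old bottom row there; the
  -- filter in `special` serves the same purpose.
  entry i j := if i = 0 then 0 else T.entry (i + 1) (j + 1)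
  entry_outside i j hij := by
    split_ifs with h
    · rfl
    · exact T.entry_outside _ _ (by omega)
  special := (T.special.preimage raise raise_injective.injOn).filter fun p => 1 ≤ p.1
  special_inner i j hij := by
    simp only [Finset.mem_filter, Finset.mem_preimage, raise] at hij
    have := T.special_inner _ _ hij.1
    omega
  special_not_adjacent i j hij := by
    simp only [Finset.mem_filter, Finset.mem_preimage, raise, not_and] at hij ⊢
    exact fun h => absurd h (T.special_not_adjacent _ _ hij.1)
  special_parents i j hij := by
    simp only [Finset.mem_filter, Finset.mem_preimage, raise] at hij
    obtain ⟨s, hs, h⟩ := T.special_parents _ _ hij.1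
    refine ⟨s, hs, ?_⟩
    rw [if_neg (by omega), if_neg (by omega), if_neg (by omega)]
    exact h
  between_of_le i j h1 h2 h3 h4 := by
    rw [if_neg (by omega), if_neg (by omega), if_neg (by omega)]
    exact (mem_betweenSet.mp (T.tail_between h1 h2 h3 h4)).1
  between_of_gt i j h1 h2 h3 h4 := by
    rw [if_neg (by omega), if_neg (by omega), if_neg (by omega)]
    exact (mem_betweenSet.mp (T.tail_between h1 h2 h3 h4)).2

/-- The second row from the bottom. -/
def secondRow (T : STriangle S (m + 1)) : Fin m → ℤ := fun j => T.entry 2 (j + 2)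

/-- The special positions in the bottom row, counted from zero. -/
def bottomSpecial (T : STriangle S (m + 1)) : Finset ℕ :=
  T.special.preimage bottom bottom_injective.injOn

theorem mem_bottomSpecial {T : STriangle S (m + 1)} {c : ℕ} :
    c ∈ T.bottomSpecial ↔ (1, c + 1) ∈ T.special := by
  simp [bottomSpecial, bottom]

theorem tail_hasBottomRow (T : STriangle S (m + 1)) : T.tail.HasBottomRow T.secondRow :=
  fun _ => rfl

theorem rowExt_secondRow (T : STriangle S (m + 1)) (j : ℕ) :
    rowExt T.secondRow j = T.entry 2 (j + 2) :=
  (T.tail_hasBottomRow.entry_eq j).symm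

theorem rowCond_bottom (T : STriangle S (m + 1)) {k : Fin (m + 1) → ℤ} (hT : T.HasBottomRow k) :
    RowCond S m (rowExt k) (rowExt T.secondRow) T.bottomSpecial where
  inner c hc := by
    have := T.special_inner _ _ (mem_bottomSpecial.mp hc)
    omega
  not_adjacent c hc := by
    rw [mem_bottomSpecial] at hc ⊢
    exact T.special_not_adjacent _ _ hc
  parents c hc := by
    obtain ⟨s, hs, h⟩ := T.special_parents _ _ (mem_bottomSpecial.mp hc)
    refine ⟨s, hs, ?_⟩
    rw [rowExt_secondRow, rowExt_secondRow, ← hT.entry_eq]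
    exact Prod.ext_iff.mp h
  between j hj h1 h2 := by
    rw [mem_bottomSpecial] at h1 h2
    rw [rowExt_secondRow, ← hT.entry_eq, ← hT.entry_eq]
    refine T.between_mem le_rfl (by omega) (by omega) ?_
    rw [isParent_succ_iff, not_or]
    exact ⟨h1, h2⟩

theorem glue_tail (T : STriangle S (m + 1)) {k : Fin (m + 1) → ℤ} (hT : T.HasBottomRow k) :
    glue (T.rowCond_bottom hT) T.tail T.tail_hasBottomRow = T := by
  refine STriangle.ext (funext₂ fun i j => ?_) (Finset.ext fun ⟨i, j⟩ => ?_)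
  · change glueEntry _ _ i j = _
    rcases i with _ | _ | i
    · exact (T.entry_zero_left j).symm
    · rcases j with _ | j
      · exact (T.entry_outside _ _ (by omega)).symm
      · exact (hT.entry_eq j).symm
    · rcases j with _ | j
      · exact (T.entry_outside _ _ (by omega)).symm
      · simp [glueEntry, tail]
  · change (i, j) ∈ glueSpecial T.bottomSpecial T.tail.special ↔ _
    constructor
    · intro h
      rcases glueSpecial_cases T.tail.one_le_of_mem_special h with
        ⟨c, hc, rfl, rfl⟩ | ⟨i, j, hij', rfl, rfl⟩
      · exact mem_bottomSpecial.mp hc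
      · simpa [tail, raise] using hij'
    · intro h
      have hi := T.special_inner _ _ h
      obtain ⟨j, rfl⟩ := Nat.exists_eq_add_of_le' (show 1 ≤ j by omega)
      rcases i with _ | _ | i
      · omega
      · rw [mem_glueSpecial_bottom T.tail.one_le_of_mem_special]
        exact mem_bottomSpecial.mpr h
      · rw [mem_glueSpecial_raise]
        simpa [tail, raise] using h

theorem tail_glue {k : Fin (m + 1) → ℤ} {b : Fin m → ℤ} {sp : Finset ℕ}
    (h : RowCond S m (rowExt k) (rowExt b) sp) (T : STriangle S m) (hT : T.HasBottomRow b) :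
    (glue h T hT).tail = T := by
  refine STriangle.ext (funext₂ fun i j => ?_) (Finset.ext fun ⟨i, j⟩ => ?_)
  · rcases i with _ | i
    · exact (T.entry_zero_left j).symm
    · rfl
  · simp only [tail, Finset.mem_filter, Finset.mem_preimage, raise]
    rcases i with _ | i
    · simpa using fun h => absurd (T.one_le_of_mem_special _ _ h) (by omega)
    · exact (and_iff_left (by omega)).trans mem_glueSpecial_raise

theorem secondRow_glue {k : Fin (m + 1) → ℤ} {b : Fin m → ℤ} {sp : Finset ℕ}
    (h : RowCond S m (rowExt k) (rowExt b) sp) (T : STriangle S m) (hT : T.HasBottomRow b) :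
    (glue h T hT).secondRow = b := funext fun j => hT j

theorem bottomSpecial_glue {k : Fin (m + 1) → ℤ} {b : Fin m → ℤ} {sp : Finset ℕ}
    (h : RowCond S m (rowExt k) (rowExt b) sp) (T : STriangle S m) (hT : T.HasBottomRow b) :
    (glue h T hT).bottomSpecial = sp := by
  ext c
  rw [mem_bottomSpecial]
  exact mem_glueSpecial_bottom T.one_le_of_mem_special

/-- A triangle is recovered from its second row, the special positions of its bottom row and the
triangle above. -/
theorem bijective_glue (k : Fin (m + 1) → ℤ) :
    Function.Bijective (fun p => ⟨glue p.1.2 p.2.1 p.2.2, glue_hasBottomRow _ _ _⟩ :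
      (Σ x : RowChoice S m k, {T : STriangle S m // T.HasBottomRow x.1.1}) →
        {T : STriangle S (m + 1) // T.HasBottomRow k}) := by
  constructor
  · rintro ⟨⟨⟨b, sp⟩, h⟩, T, hT⟩ ⟨⟨⟨b', sp'⟩, h'⟩, T', hT'⟩ e
    have e : glue h T hT = glue h' T' hT' := congrArg Subtype.val e
    have e1 := congrArg secondRow e
    have e2 := congrArg bottomSpecial e
    have e3 := congrArg tail e
    rw [secondRow_glue, secondRow_glue] at e1
    rw [bottomSpecial_glue, bottomSpecial_glue] at e2
    rw [tail_glue, tail_glue] at e3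
    dsimp only at e1 e2
    subst e1 e2 e3
    rfl
  · rintro ⟨T, hT⟩
    exact ⟨⟨⟨(T.secondRow, T.bottomSpecial), T.rowCond_bottom hT⟩, T.tail, T.tail_hasBottomRow⟩,
      Subtype.ext (T.glue_tail hT)⟩

/-- Turns the exponents into products over positions, which split when the positions are a disjoint
union. -/
theorem weight_eq_prod {n : ℕ} (f : S → ℂ) (T : STriangle S n) :
    T.weight f = (∏ _p ∈ T.inversions, (-1)) * ∏ p ∈ T.special, ∏ s : S,
      if T.entry (p.1 + 1) p.2 = T.entry p.1 p.2 + (s : ℤ × ℤ).1 ∧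
        T.entry (p.1 + 1) (p.2 + 1) = T.entry p.1 p.2 + (s : ℤ × ℤ).2 then f s else 1 := by
  rw [weight, Finset.prod_const, Finset.prod_comm]
  congr 1
  refine Finset.prod_congr rfl fun s _ => ?_
  rw [← Finset.prod_filter, Finset.prod_const]
  simp only [specialAssoc, Prod.mk.injEq]

theorem inversions_glue {k : Fin (m + 1) → ℤ} {b : Fin m → ℤ} {sp : Finset ℕ}
    (h : RowCond S m (rowExt k) (rowExt b) sp) (T : STriangle S m) (hT : T.HasBottomRow b) :
    (glue h T hT).inversions = ((range m).filter fun j =>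
      j ∉ sp ∧ j + 1 ∉ sp ∧ rowExt k j > rowExt k (j + 1)).image bottom ∪
        T.inversions.image raise := by
  ext ⟨i, j⟩
  simp only [inversions, Finset.mem_filter, Finset.mem_product, Finset.mem_Icc, Finset.mem_union,
    Finset.mem_image, bottom, raise, Prod.mk.injEq, Prod.exists, Finset.mem_range]
  constructor
  · rintro ⟨⟨⟨hi, -⟩, hj, -⟩, hij, hjm, hp, hlt⟩
    obtain ⟨j, rfl⟩ := Nat.exists_eq_add_of_le' hj
    change ¬ IsParent (glueSpecial sp T.special) _ _ at hp
    rw [isParent_succ_iff, not_or] at hp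
    rcases i with _ | _ | i
    · omega
    · rw [mem_glueSpecial_bottom T.one_le_of_mem_special,
        mem_glueSpecial_bottom T.one_le_of_mem_special] at hp
      exact Or.inl ⟨j, ⟨by omega, hp.1, hp.2, hlt⟩, rfl, rfl⟩
    · rw [mem_glueSpecial_raise, mem_glueSpecial_raise] at hp
      refine Or.inr ⟨i + 1, j, ⟨by omega, by omega, by omega, ?_, hlt⟩, rfl, rfl⟩
      rw [isParent_succ_iff, not_or]
      exact hp
  · rintro (⟨j, ⟨hj, h1, h2, hlt⟩, rfl, rfl⟩ | ⟨i, j, ⟨hij, hle, hjm, hp, hlt⟩, rfl, rfl⟩)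
    · refine ⟨by omega, by omega, by omega, ?_, hlt⟩
      change ¬ IsParent (glueSpecial sp T.special) _ _
      rw [isParent_succ_iff, not_or, mem_glueSpecial_bottom T.one_le_of_mem_special,
        mem_glueSpecial_bottom T.one_le_of_mem_special]
      exact ⟨h1, h2⟩
    · obtain ⟨i, rfl⟩ := Nat.exists_eq_add_of_le' hij.1.1
      refine ⟨by omega, by omega, by omega, ?_, hlt⟩
      change ¬ IsParent (glueSpecial sp T.special) _ _
      rw [isParent_succ_iff, not_or] at hp ⊢
      rw [mem_glueSpecial_raise, mem_glueSpecial_raise]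
      exact hp

theorem disjoint_bottom_raise (A : Finset ℕ) (B : Finset (ℕ × ℕ)) (hB : ∀ p ∈ B, 1 ≤ p.1) :
    Disjoint (A.image bottom) (B.image raise) := by
  rw [Finset.disjoint_left]
  intro p h1 h2
  simp only [Finset.mem_image] at h1 h2
  obtain ⟨c, _, rfl⟩ := h1
  obtain ⟨q, hq, h⟩ := h2
  have := hB q hq
  simp only [raise, bottom, Prod.mk.injEq] at h
  omega

theorem weight_glue (f : S → ℂ) {k : Fin (m + 1) → ℤ} {b : Fin m → ℤ} {sp : Finset ℕ}
    (h : RowCond S m (rowExt k) (rowExt b) sp) (T : STriangle S m) (hT : T.HasBottomRow b) :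
    (glue h T hT).weight f = rowWeight f m (rowExt k) (rowExt b) sp * T.weight f := by
  rw [weight_eq_prod, weight_eq_prod, inversions_glue, Finset.prod_union
    (disjoint_bottom_raise _ _ fun p hp => by
      simp only [inversions, Finset.mem_filter, Finset.mem_product, Finset.mem_Icc] at hp
      exact hp.1.1.1)]
  rw [Finset.prod_image bottom_injective.injOn, Finset.prod_image raise_injective.injOn]
  change _ * ∏ p ∈ sp.image bottom ∪ T.special.image raise, _ = _
  rw [Finset.prod_union (disjoint_bottom_raise _ _ fun p hp => T.one_le_of_mem_special _ _ hp),
    Finset.prod_image bottom_injective.injOn, Finset.prod_image raise_injective.injOn,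
    rowWeight, rowSign, Finset.prod_filter]
  have h1 : ∀ p ∈ T.special, (∏ s : S,
      if (glue h T hT).entry ((raise p).1 + 1) (raise p).2 =
          (glue h T hT).entry (raise p).1 (raise p).2 + (s : ℤ × ℤ).1 ∧
        (glue h T hT).entry ((raise p).1 + 1) ((raise p).2 + 1) =
          (glue h T hT).entry (raise p).1 (raise p).2 + (s : ℤ × ℤ).2 then f s else 1) =
      ∏ s : S, if T.entry (p.1 + 1) p.2 = T.entry p.1 p.2 + (s : ℤ × ℤ).1 ∧
        T.entry (p.1 + 1) (p.2 + 1) = T.entry p.1 p.2 + (s : ℤ × ℤ).2 then f s else 1 := by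
    rintro ⟨i, j⟩ hp
    obtain ⟨i, rfl⟩ := Nat.exists_eq_add_of_le' (T.one_le_of_mem_special _ _ hp)
    rfl
  have h2 : ∀ c ∈ sp, (∏ s : S,
      if (glue h T hT).entry ((bottom c).1 + 1) (bottom c).2 =
          (glue h T hT).entry (bottom c).1 (bottom c).2 + (s : ℤ × ℤ).1 ∧
        (glue h T hT).entry ((bottom c).1 + 1) ((bottom c).2 + 1) =
          (glue h T hT).entry (bottom c).1 (bottom c).2 + (s : ℤ × ℤ).2 then f s else 1) =
      ∏ s : S, if rowExt b (c - 1) = rowExt k c + (s : ℤ × ℤ).1 ∧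
        rowExt b c = rowExt k c + (s : ℤ × ℤ).2 then f s else 1 := by
    intro c hc
    obtain ⟨c, rfl⟩ := Nat.exists_eq_add_of_le' (h.inner c hc).1
    rw [← hT.entry_eq, ← hT.entry_eq]
    rfl
  rw [Finset.prod_congr rfl h1, Finset.prod_congr rfl h2, rowSpecial]
  ring

/-- The only triangle without rows. -/
instance uniqueZero (S : Finset (ℤ × ℤ)) (k : Fin 0 → ℤ) :
    Unique {T : STriangle S 0 // T.HasBottomRow k} where
  default := ⟨⟨fun _ _ => 0, fun _ _ _ => rfl, ∅, by simp, by simp, by simp,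
    fun _ _ _ _ h => absurd h (Nat.not_lt_zero _),
    fun _ _ _ _ h => absurd h (Nat.not_lt_zero _)⟩, fun j => j.elim0⟩
  uniq T := by
    refine Subtype.ext (STriangle.ext (funext₂ fun i j => ?_) (Finset.ext fun ⟨i, j⟩ => ?_))
    · exact T.1.entry_outside _ _ (by omega)
    · simpa using fun h => by have := T.1.special_inner i j h; omega

/-- Finiteness and the value of the sum are carried through one induction, since the bijection with
row choices and smaller triangles supplies both. -/
theorem exists_sum_weight (S : Finset (ℤ × ℤ)) (f : S → ℂ) : ∀ (n : ℕ) (k : Fin n → ℤ),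
    ∃ _ : Fintype {T : STriangle S n // T.HasBottomRow k},
      ∑ T : {T : STriangle S n // T.HasBottomRow k}, T.1.weight f = alpha S f n k
  | 0, k => by
    refine ⟨inferInstance, ?_⟩
    rw [Fintype.sum_unique, alpha, weight_eq_prod]
    simp [default, inversions]
  | m + 1, k => by
    obtain ⟨_, h⟩ := exists_sum_rowChoice S f m k
    choose inst ih using exists_sum_weight S f m
    have hb := bijective_glue (S := S) k
    refine ⟨Fintype.ofBijective _ hb, ?_⟩
    let _ := Fintype.ofBijective _ hb
    rw [← hb.sum_comp, Fintype.sum_sigma, alpha, ← h]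
    refine Finset.sum_congr rfl fun x _ => ?_
    rw [← ih, Finset.mul_sum]
    exact Finset.sum_congr rfl fun T _ => weight_glue f x.2 T.1 T.2

end STriangle

/-! ### Finiteness, the weighted count and representability of Laurent polynomials -/

theorem finite_hasBottomRow (S : Finset (ℤ × ℤ)) {n : ℕ} (k : Fin n → ℤ) :
    {T : STriangle S n | T.HasBottomRow k}.Finite := by
  -- Only the finiteness is extracted, so any weight function will do.
  obtain ⟨_, _⟩ := STriangle.exists_sum_weight S (fun _ => 0) n k
  exact Finite.of_fintype {T : STriangle S n // T.HasBottomRow k}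

theorem alpha_eq_weightedCount (S : Finset (ℤ × ℤ)) (f : S → ℂ) {n : ℕ} (k : Fin n → ℤ) :
    alpha S f n k = weightedCount S f n k := by
  obtain ⟨_, h⟩ := STriangle.exists_sum_weight S f n k
  rw [← h, weightedCount, ← finsum_eq_sum_of_fintype]
  exact finsum_set_coe_eq_finsum_mem {T : STriangle S n | T.HasBottomRow k}

/-- The swap is needed because `(i, j) ∈ S` stands for `Y ^ i * X ^ j`, while exponents list `X`
first. -/
theorem exists_eq_laurentOf (s : Laurent₂) :
    ∃ (S : Finset (ℤ × ℤ)) (f : S → ℂ), s = laurentOf S f := by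
  refine ⟨s.coeff.support.image Prod.swap, fun p => - s.coeff p.1.swap, ?_⟩
  rw [laurentOf, Finset.sum_coe_sort (s.coeff.support.image Prod.swap)
    (fun p => AddMonoidAlgebra.single (p.2, p.1) (- s.coeff p.swap)),
    Finset.sum_image Prod.swap_injective.injOn, ← Finset.sum_neg_distrib]
  conv_lhs => rw [← AddMonoidAlgebra.sum_coeff_single s]
  simp [Finsupp.sum]

end OperatorFormula

end

open OperatorFormula in
theorem mainTheorem4 (n : ℕ) (hn : 1 ≤ n) :
    -- the interpretation for every Laurent polynomial `s(X, Y)`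
    (∀ s : Laurent₂,
      (∃ (S : Finset (ℤ × ℤ)) (f : S → ℂ), s = laurentOf S f) ∧
      ∀ (S : Finset (ℤ × ℤ)) (f : S → ℂ), s = laurentOf S f → ∀ k : Fin n → ℤ,
        {T : STriangle S n | T.HasBottomRow k}.Finite ∧
        alpha S f n k = weightedCount S f n k ∧
        prodOperator n (Y + (X - 1) * (Y - 1) * s) (gtProduct n) k = weightedCount S f n k) ∧
    -- the operator formula for monotone triangles, for all bottom rows
    (∀ k : Fin n → ℤ,
      prodOperator n (1 - X + X * Y) (gtProduct n) k =
        weightedCount {((0 : ℤ), (0 : ℤ))} (fun _ => -1) n k) := by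
  refine ⟨fun s => ⟨exists_eq_laurentOf s, ?_⟩, fun k => ?_⟩
  · rintro S f rfl k
    refine ⟨finite_hasBottomRow S k, alpha_eq_weightedCount S f k, ?_⟩
    rw [← alpha_eq_weightedCount, ← prodOperator_gtProduct_eq_alpha]
  -- The case `s = 1`: here `Y + (X - 1) (Y - 1) = 1 - X + X Y`.
  · have h : (1 : Laurent₂) = laurentOf {((0 : ℤ), (0 : ℤ))} (fun _ => -1) := by
      simp [laurentOf, AddMonoidAlgebra.one_def, ← Prod.zero_eq_mk]
    have h' : (1 - X + X * Y : Laurent₂) = kernelOf 1 := by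
      unfold kernelOf
      ring
    rw [← alpha_eq_weightedCount, ← prodOperator_gtProduct_eq_alpha, h', h]
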